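/- **Lemma 6.8 (lemma:invertibility).** Let $M>0$, $|a|\le M$ and $r_+=M+\sqrt{M^2-a^2}$. Let $(\theta,\phi)$ be the standard coordinates on the sphere, $d\Omega=\sin\theta\,d\theta\,d\phi$, $Z=\partial_\phi$, and $$\mathring{\slashed\triangle}^{[-1]}=-\frac1{\sin\theta}\partial_\theta(\sin\theta\,\partial_\theta)-\frac1{\sin^2\theta}Z^2+2i\frac{\cos\theta}{\sin^2\theta}Z+\cot^2\theta,$$ $$\mathring{\slashed\triangle}^{[-1]}_{\mathcal H}=\mathring{\slashed\triangle}^{[-1]}+1+\frac{a^2}{Mr_+}\Big(1-\frac{a^2}{4Mr_+}\sin^2\theta\Big)Z^2+\frac{a}{Mr_+}\,(r_++ia\cos\theta)\,Z .$$ Regard $\mathring{\slashed\triangle}^{[-1]}_{\mathcal H}$ as an unbounded operator on the complex Hilbert space $L^2(d\Omega)$, namely the closure of its action on smooth functions of spin weight $-1$ (functions $f(\theta,\phi)$ on the sphere minus its poles such that $e^{-i\phi}f$ extends smoothly across the north pole $\theta=0$ and $e^{i\phi}f$ extends smoothly across the south pole $\theta=\pi$). Then this closure is a well-defined (single-valued)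 operator, and it is invertible: it is a bijection from its domain onto $L^2(d\Omega)$, with an inverse that is bounded on $L^2(d\Omega)$ with norm at most $2$. All its eigenvalues $\lambda\in\mathbb C$ satisfy $|\lambda|\ge\frac12$. Both bounds hold for every $|a|\le M$ and, for the eigenvalues, for every azimuthal mode number and every eigenvalue within that mode. -/

import Mathlib

open MeasureTheory Set
open scoped Real ContDiff ENNReal

namespace KerrHorizon

noncomputable section

/-- The radius `r₊ = M + √(M² - a²)` of the event horizon of the Kerr black hole with mass `M` and
specific angular momentum `a`, where `|a| ≤ M`. -/
def rPlus (M a : ℝ) : ℝ := M + √(M ^ 2 - a ^ 2)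

/-- The measure `dΩ = sin θ dθ dφ` of the unit round sphere, in the standard coordinates
`(θ, φ) ∈ (0, π) × (0, 2π]`, which miss only the two poles. -/
def sphereMeasure : Measure (ℝ × ℝ) :=
  ((volume.restrict (Ioo 0 π)).withDensity fun θ => ENNReal.ofReal (Real.sin θ)).prod
    (volume.restrict (Ioc 0 (2 * π)))

/-- The complex Hilbert space `L²(dΩ)`. -/
abbrev SphereL2 : Type := Lp ℂ 2 sphereMeasure

/-- The azimuthal vector field `Z = ∂_φ`. -/
def Z (f : ℝ → ℝ → ℂ) (θ φ : ℝ) : ℂ := deriv (fun t => f θ t) φ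

/-- The polar derivative `∂_θ`. -/
def dTheta (f : ℝ → ℝ → ℂ) (θ φ : ℝ) : ℂ := deriv (fun t => f t φ) θ

/-- The spin-`s`-weighted spherical Laplacian
`-(1/sin θ) ∂_θ (sin θ ∂_θ) - (1/sin² θ) Z² - 2 i s (cos θ/sin² θ) Z + s² cot² θ`. -/
def spinLaplacian (s : ℤ) (f : ℝ → ℝ → ℂ) (θ φ : ℝ) : ℂ :=
  -(1 / (Real.sin θ : ℂ)) * dTheta (fun t p => (Real.sin t : ℂ) * dTheta f t p) θ φ
    - 1 / (Real.sin θ : ℂ) ^ 2 * Z (Z f) θ φ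
    - 2 * Complex.I * s * ((Real.cos θ : ℂ) / (Real.sin θ : ℂ) ^ 2) * Z f θ φ
    + (s : ℂ) ^ 2 * ((Real.cos θ : ℂ) / (Real.sin θ : ℂ)) ^ 2 * f θ φ

/-- The horizon spin `-1` angular operator, as a differential expression in `(θ, φ)`:
the spin-weighted Laplacian of spin `-1`, plus `1`, plus
`(a²/(M r₊)) (1 - (a²/(4 M r₊)) sin² θ) Z² + (a/(M r₊)) (r₊ + i a cos θ) Z`. -/
def horizonExpr (M a : ℝ) (f : ℝ → ℝ → ℂ) (θ φ : ℝ) : ℂ :=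
  spinLaplacian (-1) f θ φ + f θ φ
    + ((a ^ 2 / (M * rPlus M a) *
        (1 - a ^ 2 / (4 * M * rPlus M a) * Real.sin θ ^ 2) : ℝ) : ℂ) * Z (Z f) θ φ
    + ((a / (M * rPlus M a) : ℝ) : ℂ) *
        ((rPlus M a : ℂ) + Complex.I * a * Real.cos θ) * Z f θ φ

/-- Smooth spin-`s`-weighted functions on the sphere: `e^{isφ} f` extends smoothly across the
north pole and `e^{-isφ} f` extends smoothly across the south pole. The extensions are written in
the stereographic coordinates `tan(θ/2) e^{iφ}`, which identify the sphere minus the south pole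
with `ℂ`, and `cot(θ/2) e^{iφ}`, which identify the sphere minus the north pole with `ℂ`.
Smoothness is that of functions of two real variables. -/
def IsSmoothSpinWeighted (s : ℤ) (f : ℝ → ℝ → ℂ) : Prop :=
  ∃ gN gS : ℂ → ℂ, ContDiff ℝ ∞ gN ∧ ContDiff ℝ ∞ gS ∧
    ∀ θ ∈ Ioo 0 π, ∀ φ : ℝ,
      Complex.exp (Complex.I * s * φ) * f θ φ =
          gN ((Real.tan (θ / 2) : ℂ) * Complex.exp (Complex.I * φ)) ∧
      Complex.exp (-(Complex.I * s * φ)) * f θ φ =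
          gS (((Real.tan (θ / 2))⁻¹ : ℂ) * Complex.exp (Complex.I * φ))

/-- The graph of the horizon operator acting on smooth functions of spin weight `-1`: the pairs
`(u, h)` in `L²(dΩ) × L²(dΩ)` for which `u` is (the class of) a smooth spin-`(-1)`-weighted
function `f`, and `h` is (the class of) the horizon differential expression applied to `f`. -/
def smoothGraph (M a : ℝ) : Set (SphereL2 × SphereL2) :=
  {p | ∃ f : ℝ → ℝ → ℂ, IsSmoothSpinWeighted (-1) f ∧
    (p.1 =ᵐ[sphereMeasure] fun x => f x.1 x.2) ∧
    (p.2 =ᵐ[sphereMeasure] fun x => horizonExpr M a f x.1 x.2)}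

/-- The graph of the horizon operator as a closed unbounded operator on `L²(dΩ)`: the closure of
the operator acting on smooth functions of spin weight `-1`. -/
def horizonGraph (M a : ℝ) : Set (SphereL2 × SphereL2) := closure (smoothGraph M a)

end

end KerrHorizon

/-!
In the azimuthal mode `m`, the functions of spin weight `s` are `e^{imφ}` times a fixed profile
times a polynomial in `x = cos θ`, and the operator acts on the polynomial. The spin-weighted
Laplacian is symmetric, bounded below by `ℓ (ℓ + 1) - s²` with `ℓ = max |m| |s|`, and does not
raise degrees; the remaining terms act as multiplication by a polynomial whose imaginary part is
the constant `ν m`, where `ν = a/M`. Either `m ≠ 0` and `|ν| > 1/2`, and the imaginary part of the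
quadratic form is at least `1/2`, or its real part is. This gives the bound `2` for the inverse on
finite sums of modes. A vector orthogonal to the range in one mode vanishes on that mode, by a
Galerkin approximation with polynomials of bounded degree, and the modes are total by the
Stone-Weierstrass theorem on the sphere, so the range is dense. The formal adjoint is the same
operator with `-ν` for `ν`; Green's identity thus transfers density of modes and of the adjoint
range into single-valuedness and injectivity of the closure.
-/

namespace KerrHorizon

noncomputable section

open Filter Polynomial
open Complex (I)
open scoped ComplexConjugate InnerProductSpace Topology

section Galerkin

variable {𝕜 E V : Type*} [RCLike 𝕜] [NormedAddCommGroup E] [InnerProductSpace 𝕜 E]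
  [AddCommGroup V] [Module 𝕜 V]

theorem inner_starProjection_left_of_mem {S : Submodule 𝕜 E} [S.HasOrthogonalProjection] (v : E)
    {x : E} (hx : x ∈ S) : ⟪S.starProjection v, x⟫_𝕜 = ⟪v, x⟫_𝕜 := by
  rw [S.inner_starProjection_left_eq_right, Submodule.starProjection_eq_self_iff.mpr hx]

/-- The Galerkin approximation `y` of `v` satisfies `⟨y, (D + B) y⟩ = ⟨y - v, B y⟩`, because `D y`
stays in the subspace on which `y` and `v` have the same scalar products. -/
theorem galerkin_estimate {ι : V →ₗ[𝕜] E} {D B : V →ₗ[𝕜] V} {K : Submodule 𝕜 V}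
    [FiniteDimensional 𝕜 (K.map ι)] (hD : ∀ x ∈ K, D x ∈ K) {C δ : ℝ}
    (hB : ∀ x, ‖ι (B x)‖ ≤ C * ‖ι x‖)
    (hform : ∀ x, δ * ‖ι x‖ ^ 2 ≤ ‖⟪ι x, ι (D x + B x)⟫_𝕜‖)
    {v : E} (hv : ∀ x, ⟪v, ι (D x + B x)⟫_𝕜 = 0) :
    δ * ‖(K.map ι).starProjection v‖ ^ 2 ≤
      ‖(K.map ι).starProjection v - v‖ * (C * ‖(K.map ι).starProjection v‖) := by
  obtain ⟨y, hy, hyv⟩ := Submodule.mem_map.mp ((K.map ι).starProjection_apply_mem v)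
  have hDy : ⟪ι y, ι (D y)⟫_𝕜 = ⟪v, ι (D y)⟫_𝕜 := by
    rw [hyv, inner_starProjection_left_of_mem v (Submodule.mem_map_of_mem (hD y hy))]
  have hform_eq : ⟪ι y, ι (D y + B y)⟫_𝕜 = ⟪ι y - v, ι (B y)⟫_𝕜 := by
    have := hv y
    rw [map_add, inner_add_right] at this ⊢
    rw [hDy, inner_sub_left, eq_neg_of_add_eq_zero_left this, neg_add_eq_sub]
  rw [← hyv]
  calc δ * ‖ι y‖ ^ 2 ≤ ‖⟪ι y - v, ι (B y)⟫_𝕜‖ := hform_eq ▸ hform y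
    _ ≤ ‖ι y - v‖ * ‖ι (B y)‖ := norm_inner_le_norm _ _
    _ ≤ ‖ι y - v‖ * (C * ‖ι y‖) := by gcongr; exact hB y

/-- Galerkin's argument: a vector orthogonal to the range of a coercive operator `D + B`, with `B`
bounded and `D` preserving an exhaustion by finite-dimensional subspaces, is orthogonal to its
domain. -/
theorem inner_eq_zero_of_galerkin [CompleteSpace E] (ι : V →ₗ[𝕜] E) (D B : V →ₗ[𝕜] V)
    {K : ℕ → Submodule 𝕜 V} (hKmono : Monotone K) (hKfin : ∀ n, FiniteDimensional 𝕜 (K n))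
    (hKtop : ∀ x, ∃ n, x ∈ K n) (hD : ∀ n, ∀ x ∈ K n, D x ∈ K n)
    {C δ : ℝ} (hδ : 0 < δ) (hB : ∀ x, ‖ι (B x)‖ ≤ C * ‖ι x‖)
    (hform : ∀ x, δ * ‖ι x‖ ^ 2 ≤ ‖⟪ι x, ι (D x + B x)⟫_𝕜‖)
    {v : E} (hv : ∀ x, ⟪v, ι (D x + B x)⟫_𝕜 = 0) (x : V) : ⟪v, ι x⟫_𝕜 = 0 := by
  let S : ℕ → Submodule 𝕜 E := fun n => (K n).map ι
  let W : Submodule 𝕜 E := (⨆ n, S n).topologicalClosure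
  have : CompleteSpace W := (⨆ n, S n).isClosed_topologicalClosure.completeSpace_coe
  have hmem : ∀ y, ι y ∈ W := fun y =>
    let ⟨n, hn⟩ := hKtop y
    Submodule.le_topologicalClosure _ (le_iSup S n (Submodule.mem_map_of_mem hn))
  let w : E := W.starProjection v
  have hw : ∀ y, ⟪w, ι y⟫_𝕜 = ⟪v, ι y⟫_𝕜 := fun y => inner_starProjection_left_of_mem v (hmem y)
  have hlim : Tendsto (fun n => (S n).starProjection w) atTop (𝓝 w) := by
    have h := Submodule.starProjection_tendsto_closure_iSup S
      (fun m n h => Submodule.map_mono (hKmono h)) w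
    rwa [Submodule.starProjection_eq_self_iff.mpr (W.starProjection_apply_mem v)] at h
  have hlimit : δ * ‖w‖ ^ 2 ≤ ‖w - w‖ * (C * ‖w‖) :=
    le_of_tendsto_of_tendsto' ((hlim.norm.pow 2).const_mul δ)
      ((hlim.sub_const w).norm.mul (hlim.norm.const_mul C))
      fun n => galerkin_estimate (hD n) hB hform fun y => (hw _).trans (hv y)
  have hw0 : w = 0 := by
    rw [sub_self, norm_zero, zero_mul] at hlimit
    have : ‖w‖ ^ 2 = 0 := le_antisymm (nonpos_of_mul_nonpos_right hlimit hδ) (by positivity)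
    simpa using this
  rw [← hw, hw0, inner_zero_left]

theorem mul_norm_le_of_le_norm_inner {x y : E} {δ : ℝ} (h : δ * ‖x‖ ^ 2 ≤ ‖⟪x, y⟫_𝕜‖) :
    δ * ‖x‖ ≤ ‖y‖ := by
  rcases (norm_nonneg x).eq_or_lt with hx | hx
  · rw [← hx, mul_zero]; positivity
  · nlinarith [h.trans (norm_inner_le_norm x y)]

end Galerkin

theorem exists_bounded_inverse_of_denseRange {𝕜 E V : Type*} [RCLike 𝕜] [NormedAddCommGroup E]
    [NormedSpace 𝕜 E] [CompleteSpace E] [AddCommGroup V] [Module 𝕜 V] (ι T : V →ₗ[𝕜] E) {C : ℝ}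
    (hC : 0 ≤ C) (hbound : ∀ x, ‖ι x‖ ≤ C * ‖T x‖) (hdense : DenseRange T) :
    ∃ R : E →L[𝕜] E, ‖R‖ ≤ C ∧ ∀ h, (R h, h) ∈ closure (range fun x => (ι x, T x)) := by
  have hR := LinearMap.extendOfNorm_eq hdense ⟨C, hbound⟩
  refine ⟨ι.extendOfNorm T, LinearMap.opNorm_extendOfNorm_le hdense hC hbound, fun h => ?_⟩
  refine hdense.induction_on (p := fun k => (ι.extendOfNorm T k, k) ∈ closure _) h
    (isClosed_closure.preimage (by fun_prop)) fun x => ?_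
  rw [hR]
  exact subset_closure ⟨x, rfl⟩

theorem one_le_opNorm_mul_norm_of_eq_apply_smul {𝕜 E : Type*} [NontriviallyNormedField 𝕜]
    [NormedAddCommGroup E] [NormedSpace 𝕜 E] (R : E →L[𝕜] E) {c : 𝕜} {u : E} (hu : u ≠ 0)
    (h : u = R (c • u)) : 1 ≤ ‖R‖ * ‖c‖ := by
  refine le_of_mul_le_mul_right ?_ (norm_pos_iff.mpr hu)
  calc 1 * ‖u‖ = ‖R (c • u)‖ := by rw [one_mul, ← h]
    _ ≤ ‖R‖ * ‖c • u‖ := R.le_opNorm _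
    _ = ‖R‖ * ‖c‖ * ‖u‖ := by rw [norm_smul, mul_assoc]

section Polynomials

theorem natCast_mul_pow_sub_one_mul {R : Type*} [CommSemiring R] (n : ℕ) (z : R) :
    n * z ^ (n - 1) * z = n * z ^ n := by
  rcases n.eq_zero_or_pos with rfl | hn
  · simp
  · rw [mul_assoc, pow_sub_one_mul hn.ne']

theorem mul_derivative_pow {R : Type*} [CommSemiring R] (P : R[X]) (n : ℕ) :
    P * derivative (P ^ n) = n * P ^ n * derivative P := by
  rw [derivative_pow, map_natCast, ← natCast_mul_pow_sub_one_mul]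
  ring

variable (s m : ℤ)

/-- The order of vanishing at the north pole of the functions of spin weight `s` and azimuthal mode
`m`. -/
def northOrder : ℕ := (m + s).natAbs

/-- The order of vanishing at the south pole of the functions of spin weight `s` and azimuthal mode
`m`. -/
def southOrder : ℕ := (m - s).natAbs

/-- The lowest angular momentum `ℓ = max |m| |s|` of the functions of spin weight `s` and azimuthal
mode `m`. -/
def lowestSpin : ℕ := max m.natAbs s.natAbs

theorem northOrder_add_southOrder : northOrder s m + southOrder s m = 2 * lowestSpin s m := by
  unfold northOrder southOrder lowestSpin; omega

theorem northOrder_add_southOrder_cast :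
    (northOrder s m : ℂ) + southOrder s m = 2 * lowestSpin s m :=
  mod_cast northOrder_add_southOrder s m

theorem northOrder_sq : (northOrder s m : ℂ) ^ 2 = (m + s) ^ 2 := by
  exact_mod_cast Int.natAbs_sq (m + s)

theorem southOrder_sq : (southOrder s m : ℂ) ^ 2 = (m - s) ^ 2 := by
  exact_mod_cast Int.natAbs_sq (m - s)

/-- The weight `((1 - x)/2)^p ((1 + x)/2)^q` of the scalar product of the mode `m` in the variable
`x = cos θ`. -/
def weight : ℂ[X] :=
  (C (1 / 2) * (1 - X)) ^ northOrder s m * (C (1 / 2) * (1 + X)) ^ southOrder s m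

/-- The polynomial `A` for which `sin θ ∂_θ` acts on the mode `m` as `A - (1 - x²) ∂_x`. -/
def driftPoly : ℂ[X] :=
  C (((northOrder s m : ℂ) - southOrder s m) / 2) + C (lowestSpin s m : ℂ) * X

/-- The operator `sin θ ∂_θ`, acting on the polynomial part of the mode `m`. -/
def polarPoly (P : ℂ[X]) : ℂ[X] := driftPoly s m * P - (1 - X ^ 2) * derivative P

/-- The spin-`s` Laplacian, acting on the polynomial part of the mode `m`. -/
def laplacianPoly : ℂ[X] →ₗ[ℂ] ℂ[X] :=
  LinearMap.mulLeft ℂ (C ((lowestSpin s m : ℂ) * (lowestSpin s m + 1) - s ^ 2)) +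
    (LinearMap.mulLeft ℂ (2 * driftPoly s m)).comp derivative -
    derivative.comp ((LinearMap.mulLeft ℂ (1 - X ^ 2)).comp derivative)

theorem laplacianPoly_apply (P : ℂ[X]) : laplacianPoly s m P =
    C ((lowestSpin s m : ℂ) * (lowestSpin s m + 1) - s ^ 2) * P +
      2 * driftPoly s m * derivative P - derivative ((1 - X ^ 2) * derivative P) := rfl

theorem driftPoly_sq : driftPoly s m ^ 2 =
    (C (m : ℂ) + C (s : ℂ) * X) ^ 2 - (1 - X ^ 2) * C ((lowestSpin s m : ℂ) ^ 2 - s ^ 2) := by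
  have hsum := northOrder_add_southOrder_cast s m
  have hnorth := northOrder_sq s m
  have hsouth := southOrder_sq s m
  have hprod : ((northOrder s m : ℂ) - southOrder s m) / 2 * lowestSpin s m = m * s := by
    linear_combination (-(northOrder s m - southOrder s m : ℂ) * hsum + hnorth - hsouth) / 4
  have hsq : (((northOrder s m : ℂ) - southOrder s m) / 2) ^ 2 + (lowestSpin s m : ℂ) ^ 2 =
      m ^ 2 + s ^ 2 := by
    linear_combination (-(northOrder s m + southOrder s m + 2 * lowestSpin s m : ℂ) * hsum) / 4 +
      (hnorth + hsouth) / 2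
  have hprod' := congrArg C hprod
  have hsq' := congrArg C hsq
  simp only [C_add, C_mul, C_pow] at hprod' hsq'
  simp only [driftPoly, C_sub, C_pow]
  linear_combination 2 * X * hprod' + hsq'

theorem polarPoly_polarPoly (P : ℂ[X]) : polarPoly s m (polarPoly s m P) =
    (C (m : ℂ) + C (s : ℂ) * X) ^ 2 * P - (1 - X ^ 2) * laplacianPoly s m P := by
  have hdrift : derivative (driftPoly s m) = C (lowestSpin s m : ℂ) := by
    simp only [driftPoly, derivative_add, derivative_C, derivative_C_mul, derivative_X]
    ring
  simp only [polarPoly, laplacianPoly_apply, derivative_sub (f := driftPoly s m * P),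
    derivative_mul (f := driftPoly s m), hdrift, C_sub, C_mul, C_add, C_1, C_pow]
  have hsq := driftPoly_sq s m
  simp only [C_sub, C_pow] at hsq
  linear_combination P * hsq

theorem one_sub_sq_mul_derivative_weight :
    (1 - X ^ 2) * derivative (weight s m) = -(2 * driftPoly s m * weight s m) := by
  have hnorth := mul_derivative_pow (C (1 / 2) * (1 - X) : ℂ[X]) (northOrder s m)
  have hsouth := mul_derivative_pow (C (1 / 2) * (1 + X) : ℂ[X]) (southOrder s m)
  have hdrift : 2 * driftPoly s m =
      (northOrder s m : ℂ[X]) * (1 + X) - (southOrder s m : ℂ[X]) * (1 - X) := by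
    have hsum := congrArg C (northOrder_add_southOrder_cast s m)
    have hdiff := congrArg C (mul_div_cancel₀ ((northOrder s m : ℂ) - southOrder s m) two_ne_zero)
    simp only [C_add, C_sub, C_mul, map_natCast, map_ofNat] at hsum hdiff
    simp only [driftPoly, map_natCast]
    linear_combination -X * hsum + hdiff
  have htwo : (2 : ℂ[X]) * C (1 / 2) = 1 := by rw [← C_ofNat, ← C_mul]; norm_num
  rw [hdrift, weight]
  simp only [derivative_mul, derivative_C, derivative_sub, derivative_add, derivative_one,
    derivative_X, zero_mul, zero_add, zero_sub, mul_one] at hnorth hsouth ⊢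
  set n := C (1 / 2) * (1 - X : ℂ[X])
  set t := C (1 / 2) * (1 + X : ℂ[X])
  linear_combination 2 * (1 + X) * t ^ southOrder s m * hnorth +
    2 * (1 - X) * n ^ northOrder s m * hsouth
    - ((1 - X ^ 2) * (derivative (n ^ northOrder s m) * t ^ southOrder s m +
      n ^ northOrder s m * derivative (t ^ southOrder s m)) +
      ((northOrder s m : ℂ[X]) * (1 + X) - southOrder s m * (1 - X)) *
        (n ^ northOrder s m * t ^ southOrder s m)) * htwo

theorem weight_mul_laplacianPoly (P Q : ℂ[X]) : weight s m * Q * laplacianPoly s m P =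
    C ((lowestSpin s m : ℂ) * (lowestSpin s m + 1) - s ^ 2) * (weight s m * Q * P) +
      weight s m * (1 - X ^ 2) * (derivative Q * derivative P) -
      derivative (weight s m * (1 - X ^ 2) * derivative P * Q) := by
  rw [laplacianPoly_apply]
  simp only [derivative_mul]
  linear_combination (derivative P * Q) * one_sub_sq_mul_derivative_weight s m

theorem laplacianPoly_mem_degreeLT {n : ℕ} {P : ℂ[X]} (hP : P ∈ degreeLT ℂ n) :
    laplacianPoly s m P ∈ degreeLT ℂ n := by
  rcases n with _ | n
  · rw [mem_degreeLT, Nat.cast_zero, Nat.WithBot.lt_zero_iff, degree_eq_bot] at hP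
    rw [hP, map_zero]
    exact zero_mem _
  rw [degreeLT_succ_eq_degreeLE, mem_degreeLE, ← natDegree_le_iff_degree_le] at hP ⊢
  have hderivative : (derivative P).natDegree ≤ n - 1 :=
    (natDegree_derivative_le P).trans (by omega)
  have hdrift : (2 * driftPoly s m).natDegree ≤ 1 := by
    rw [driftPoly, ← C_ofNat]
    compute_degree
  have hsq : (1 - X ^ 2 : ℂ[X]).natDegree ≤ 2 := by compute_degree
  rw [laplacianPoly_apply]
  rcases n.eq_zero_or_pos with rfl | hn
  · rw [natDegree_eq_zero_iff_degree_le_zero.mp (Nat.le_zero.mp hP) |> eq_C_of_degree_le_zero]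
    simp [← C_mul, -map_sub, -map_mul]
  refine (natDegree_sub_le _ _).trans (max_le ((natDegree_add_le _ _).trans (max_le ?_ ?_)) ?_)
  · exact (natDegree_C_mul_le _ _).trans hP
  · exact natDegree_mul_le.trans (by omega)
  · have := (natDegree_derivative_le ((1 - X ^ 2) * derivative P)).trans
      (Nat.sub_le_sub_right natDegree_mul_le 1)
    omega

theorem eval_map_conj (P : ℂ[X]) (x : ℝ) :
    (P.map (starRingEnd ℂ)).eval (x : ℂ) = conj (P.eval (x : ℂ)) := by
  rw [eval_map, ← eval₂_at_apply, Complex.conj_ofReal]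

theorem continuous_eval_cos (P : ℂ[X]) : Continuous fun θ : ℝ => P.eval (Real.cos θ : ℂ) :=
  P.continuous.comp (Complex.continuous_ofReal.comp Real.continuous_cos)

theorem exists_bound_eval_cos (P : ℂ[X]) : ∃ K, ∀ θ : ℝ, ‖P.eval (Real.cos θ : ℂ)‖ ≤ K := by
  obtain ⟨K, hK⟩ := (isCompact_Icc (a := (-1 : ℝ)) (b := 1)).exists_bound_of_continuousOn
    (f := fun x : ℝ => P.eval (x : ℂ)) (P.continuous.comp Complex.continuous_ofReal).continuousOn
  exact ⟨K, fun θ => hK _ ⟨Real.neg_one_le_cos θ, Real.cos_le_one θ⟩⟩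

theorem integral_derivative_eval_cos (P : ℂ[X]) :
    ∫ θ in (0 : ℝ)..π, (derivative P).eval (Real.cos θ : ℂ) * Real.sin θ =
      P.eval 1 - P.eval (-1) := by
  have hderiv : ∀ θ ∈ uIcc 0 π, HasDerivAt (fun θ : ℝ => -P.eval (Real.cos θ : ℂ))
      ((derivative P).eval (Real.cos θ : ℂ) * Real.sin θ) θ := fun θ _ => by
    convert! ((P.hasDerivAt (Real.cos θ : ℂ)).comp θ (Real.hasDerivAt_cos θ).ofReal_comp).neg
      using 1
    push_cast
    ring
  have hcont : Continuous fun θ : ℝ => (derivative P).eval (Real.cos θ : ℂ) * Real.sin θ :=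
    (continuous_eval_cos _).mul (Complex.continuous_ofReal.comp Real.continuous_sin)
  rw [intervalIntegral.integral_eq_sub_of_hasDerivAt hderiv (hcont.intervalIntegrable _ _)]
  simp only [Real.cos_pi, Real.cos_zero, Complex.ofReal_neg, Complex.ofReal_one]
  ring

end Polynomials

section Modes

instance : IsFiniteMeasure sphereMeasure := by
  have : IsFiniteMeasure ((volume.restrict (Ioo 0 π)).withDensity
      fun θ => ENNReal.ofReal (Real.sin θ)) :=
    isFiniteMeasure_withDensity_ofReal
      ((Real.continuous_sin.integrableOn_Icc (a := 0) (b := π)).mono_set Ioo_subset_Icc_self).2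
  unfold sphereMeasure
  infer_instance

theorem integral_sphereMeasure_mul (f g : ℝ → ℂ) :
    ∫ x, f x.1 * g x.2 ∂sphereMeasure =
      (∫ θ in (0 : ℝ)..π, f θ * Real.sin θ) * ∫ φ in (0 : ℝ)..2 * π, g φ := by
  rw [sphereMeasure, integral_prod_mul, intervalIntegral.integral_of_le Real.two_pi_pos.le,
    intervalIntegral.integral_of_le Real.pi_pos.le]
  congr 1
  rw [integral_Ioc_eq_integral_Ioo (x := (0 : ℝ)) (y := π),
    integral_withDensity_eq_integral_toReal_smul (by fun_prop) (by simp)]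
  refine setIntegral_congr_fun measurableSet_Ioo fun θ hθ => ?_
  simp only [ENNReal.toReal_ofReal (Real.sin_pos_of_mem_Ioo hθ).le, Complex.real_smul]
  ring

variable (s m : ℤ)

/-- The common factor `sin(θ/2)^p cos(θ/2)^q` of the functions of spin weight `s` and azimuthal
mode `m`. -/
def modeProfile (θ : ℝ) : ℝ :=
  Real.sin (θ / 2) ^ northOrder s m * Real.cos (θ / 2) ^ southOrder s m

/-- The function `e^{imφ} sin(θ/2)^p cos(θ/2)^q P(cos θ)` of spin weight `s` and azimuthal
mode `m`. -/
def modeFun (P : ℂ[X]) (θ φ : ℝ) : ℂ :=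
  Complex.exp (I * m * φ) * (modeProfile s m θ * P.eval (Real.cos θ : ℂ))

theorem continuous_modeProfile : Continuous (modeProfile s m) := by
  unfold modeProfile
  fun_prop

theorem abs_modeProfile_le_one (θ : ℝ) : |modeProfile s m θ| ≤ 1 := by
  rw [modeProfile, abs_mul, abs_pow, abs_pow]
  exact mul_le_one₀ (pow_le_one₀ (abs_nonneg _) (Real.abs_sin_le_one _)) (by positivity)
    (pow_le_one₀ (abs_nonneg _) (Real.abs_cos_le_one _))

theorem modeFun_add (P Q : ℂ[X]) (θ φ : ℝ) :
    modeFun s m (P + Q) θ φ = modeFun s m P θ φ + modeFun s m Q θ φ := by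
  simp only [modeFun, eval_add]; ring

theorem modeFun_mul (P Q : ℂ[X]) (θ φ : ℝ) :
    modeFun s m (P * Q) θ φ = P.eval (Real.cos θ : ℂ) * modeFun s m Q θ φ := by
  simp only [modeFun, eval_mul]; ring

theorem continuous_modeFun (P : ℂ[X]) :
    Continuous fun x : ℝ × ℝ => modeFun s m P x.1 x.2 := by
  have hprofile := continuous_modeProfile s m
  have heval := (continuous_eval_cos P).comp (continuous_fst (X := ℝ) (Y := ℝ))
  unfold modeFun
  exact .mul (by fun_prop) (.mul (by fun_prop) heval)

theorem exists_bound_modeFun (P : ℂ[X]) : ∃ K, ∀ θ φ, ‖modeFun s m P θ φ‖ ≤ K := by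
  obtain ⟨K, hK⟩ := exists_bound_eval_cos P
  refine ⟨K, fun θ φ => ?_⟩
  have hexp : ‖Complex.exp (I * m * φ)‖ = 1 := by
    rw [show I * m * φ = ((m * φ : ℝ) : ℂ) * I by push_cast; ring, Complex.norm_exp_ofReal_mul_I]
  rw [modeFun, norm_mul, hexp, one_mul, norm_mul, Complex.norm_real, Real.norm_eq_abs]
  exact (mul_le_of_le_one_left (norm_nonneg _) (abs_modeProfile_le_one s m θ)).trans (hK θ)

theorem memLp_modeFun (P : ℂ[X]) :
    MemLp (fun x : ℝ × ℝ => modeFun s m P x.1 x.2) 2 sphereMeasure := by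
  obtain ⟨K, hK⟩ := exists_bound_modeFun s m P
  exact .of_bound (continuous_modeFun s m P).aestronglyMeasurable K (.of_forall fun x => hK _ _)

/-- The class in `L²(dΩ)` of `modeFun s m P`. -/
def modeL2 : ℂ[X] →ₗ[ℂ] SphereL2 where
  toFun P := (memLp_modeFun s m P).toLp _
  map_add' P Q := by
    rw [← MemLp.toLp_add]
    exact MemLp.toLp_congr _ ((memLp_modeFun s m P).add (memLp_modeFun s m Q))
      (.of_forall fun x => modeFun_add s m P Q x.1 x.2)
  map_smul' c P := by
    rw [RingHom.id_apply, ← MemLp.toLp_const_smul]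
    refine MemLp.toLp_congr _ ((memLp_modeFun s m P).const_smul c) (.of_forall fun x => ?_)
    exact (congrArg (modeFun s m · x.1 x.2) (smul_eq_C_mul c)).trans
      ((modeFun_mul s m (C c) P x.1 x.2).trans (by rw [eval_C]; rfl))

theorem coeFn_modeL2 (P : ℂ[X]) :
    modeL2 s m P =ᵐ[sphereMeasure] fun x => modeFun s m P x.1 x.2 :=
  (memLp_modeFun s m P).coeFn_toLp

theorem exists_norm_modeL2_mul_le (Q : ℂ[X]) :
    ∃ K, ∀ P, ‖modeL2 s m (Q * P)‖ ≤ K * ‖modeL2 s m P‖ := by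
  obtain ⟨K, hK⟩ := exists_bound_eval_cos Q
  refine ⟨K, fun P => Lp.norm_le_mul_norm_of_ae_le_mul ?_⟩
  filter_upwards [coeFn_modeL2 s m (Q * P), coeFn_modeL2 s m P] with x hQP hP
  rw [hQP, hP, modeFun_mul, norm_mul]
  gcongr
  exact hK _

theorem inner_modeL2 (n : ℤ) (P Q : ℂ[X]) : ⟪modeL2 s m P, modeL2 s n Q⟫_ℂ =
    (∫ θ in (0 : ℝ)..π, (modeProfile s n θ * Q.eval (Real.cos θ : ℂ)) *
        conj (modeProfile s m θ * P.eval (Real.cos θ : ℂ)) * Real.sin θ) *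
      ∫ φ in (0 : ℝ)..2 * π, Complex.exp (I * ((n - m : ℤ) : ℂ) * φ) := by
  rw [L2.inner_def, ← integral_sphereMeasure_mul (fun θ : ℝ => (modeProfile s n θ *
    Q.eval (Real.cos θ : ℂ)) * conj (modeProfile s m θ * P.eval (Real.cos θ : ℂ)))]
  refine integral_congr_ae ?_
  filter_upwards [coeFn_modeL2 s m P, coeFn_modeL2 s n Q] with x hP hQ
  have hexp : Complex.exp (I * ((n - m : ℤ) : ℂ) * x.2) =
      Complex.exp (I * n * x.2) * conj (Complex.exp (I * m * x.2)) := by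
    rw [← Complex.exp_conj, ← Complex.exp_add]
    simp only [map_mul, Complex.conj_I, Complex.conj_ofReal, map_intCast, Int.cast_sub]
    congr 1
    ring
  rw [hP, hQ, RCLike.inner_apply, hexp, modeFun, modeFun, map_mul]
  ring

theorem integral_exp_mode {k : ℤ} (hk : k ≠ 0) :
    ∫ φ in (0 : ℝ)..2 * π, Complex.exp (I * k * φ) = 0 := by
  rw [integral_exp_mul_complex (mul_ne_zero Complex.I_ne_zero (mod_cast hk)),
    show I * k * ((2 * π : ℝ) : ℂ) = k * (2 * π * I) by push_cast; ring,
    Complex.exp_int_mul_two_pi_mul_I, Complex.ofReal_zero, mul_zero, Complex.exp_zero, sub_self,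
    zero_div]

theorem inner_modeL2_of_ne {m n : ℤ} (h : m ≠ n) (P Q : ℂ[X]) :
    ⟪modeL2 s m P, modeL2 s n Q⟫_ℂ = 0 := by
  rw [inner_modeL2, integral_exp_mode (sub_ne_zero.mpr h.symm), mul_zero]

theorem half_mul_one_sub_cos (θ : ℝ) :
    (1 / 2 : ℂ) * (1 - Real.cos θ) = (Real.sin (θ / 2) : ℂ) ^ 2 := by
  rw [← Complex.ofReal_pow, Real.sin_sq_eq_half_sub, mul_div_cancel₀ _ two_ne_zero]
  push_cast
  ring

theorem half_mul_one_add_cos (θ : ℝ) :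
    (1 / 2 : ℂ) * (1 + Real.cos θ) = (Real.cos (θ / 2) : ℂ) ^ 2 := by
  rw [← Complex.ofReal_pow, Real.cos_sq, mul_div_cancel₀ _ two_ne_zero]
  push_cast
  ring

theorem eval_weight_cos (θ : ℝ) :
    (weight s m).eval (Real.cos θ : ℂ) = (modeProfile s m θ : ℂ) ^ 2 := by
  simp only [weight, modeProfile, eval_mul, eval_C, eval_pow, eval_sub, eval_add, eval_one, eval_X,
    half_mul_one_sub_cos, half_mul_one_add_cos, Complex.ofReal_mul, Complex.ofReal_pow]
  ring

theorem inner_modeL2_self (P Q : ℂ[X]) : ⟪modeL2 s m P, modeL2 s m Q⟫_ℂ =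
    2 * π * ∫ θ in (0 : ℝ)..π,
      (weight s m * P.map (starRingEnd ℂ) * Q).eval (Real.cos θ : ℂ) * Real.sin θ := by
  have hperiod : ∫ φ in (0 : ℝ)..2 * π, Complex.exp (I * ((m - m : ℤ) : ℂ) * φ) = 2 * π := by
    simp
  rw [inner_modeL2, hperiod, mul_comm]
  congr 2 with θ
  simp only [map_mul, Complex.conj_ofReal, eval_mul, eval_map_conj, eval_weight_cos]
  ring

/-- The density in `θ` of the square of the `L²(dΩ)` norm of `modeFun s m P`, up to the factor
`2π`. -/
def modeDensity (P : ℂ[X]) (θ : ℝ) : ℝ :=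
  modeProfile s m θ ^ 2 * ‖P.eval (Real.cos θ : ℂ)‖ ^ 2 * Real.sin θ

theorem continuous_modeDensity (P : ℂ[X]) : Continuous (modeDensity s m P) :=
  (((continuous_modeProfile s m).pow 2).mul ((continuous_eval_cos P).norm.pow 2)).mul
    Real.continuous_sin

theorem modeDensity_nonneg (P : ℂ[X]) {θ : ℝ} (hθ : θ ∈ Icc 0 π) : 0 ≤ modeDensity s m P θ :=
  mul_nonneg (by positivity) (Real.sin_nonneg_of_mem_Icc hθ)

theorem eval_weight_mul_conj_mul (P : ℂ[X]) (θ : ℝ) :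
    (weight s m * P.map (starRingEnd ℂ) * P).eval (Real.cos θ : ℂ) * Real.sin θ =
      modeDensity s m P θ := by
  rw [eval_mul, eval_mul, eval_map_conj, mul_assoc _ (conj _), Complex.conj_mul',
    eval_weight_cos, modeDensity]
  push_cast
  ring

theorem norm_modeL2_sq (P : ℂ[X]) :
    ‖modeL2 s m P‖ ^ 2 = 2 * π * ∫ θ in (0 : ℝ)..π, modeDensity s m P θ := by
  have h : ⟪modeL2 s m P, modeL2 s m P⟫_ℂ = (‖modeL2 s m P‖ : ℂ) ^ 2 :=
    inner_self_eq_norm_sq_to_K _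
  simp_rw [inner_modeL2_self, eval_weight_mul_conj_mul] at h
  rw [intervalIntegral.integral_ofReal] at h
  exact_mod_cast h.symm

end Modes

section Coercivity

variable (s m : ℤ)

theorem inner_modeL2_mul_self (V P : ℂ[X]) : ⟪modeL2 s m P, modeL2 s m (V * P)⟫_ℂ =
    2 * π * ∫ θ in (0 : ℝ)..π, V.eval (Real.cos θ : ℂ) * modeDensity s m P θ := by
  rw [inner_modeL2_self]
  congr 2 with θ
  rw [← eval_weight_mul_conj_mul]
  simp only [eval_mul]
  ring

/-- Integration by parts; the boundary terms vanish with the factor `1 - x²`. -/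
theorem inner_modeL2_laplacianPoly (P : ℂ[X]) :
    ⟪modeL2 s m P, modeL2 s m (laplacianPoly s m P)⟫_ℂ =
      ((2 * π * ∫ θ in (0 : ℝ)..π,
        (((lowestSpin s m : ℝ) * (lowestSpin s m + 1) - s ^ 2) * modeDensity s m P θ +
          Real.sin θ ^ 2 * modeDensity s m (derivative P) θ) : ℝ) : ℂ) := by
  set B := weight s m * (1 - X ^ 2) * derivative P * P.map (starRingEnd ℂ) with hB
  have hpoint : ∀ θ : ℝ, (weight s m * P.map (starRingEnd ℂ) * laplacianPoly s m P).eval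
      (Real.cos θ : ℂ) * Real.sin θ =
      ((((lowestSpin s m : ℝ) * (lowestSpin s m + 1) - s ^ 2) * modeDensity s m P θ +
          Real.sin θ ^ 2 * modeDensity s m (derivative P) θ : ℝ) : ℂ) -
        (derivative B).eval (Real.cos θ : ℂ) * Real.sin θ := fun θ => by
    have hderiv := eval_weight_mul_conj_mul s m (derivative P) θ
    rw [← derivative_map] at hderiv
    rw [Real.sin_sq, weight_mul_laplacianPoly, ← hB]
    simp only [Complex.ofReal_add, Complex.ofReal_mul _ (modeDensity _ _ _ _), ← hderiv,
      ← eval_weight_mul_conj_mul]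
    simp only [eval_add, eval_sub, eval_mul, eval_C, eval_one, eval_pow, eval_X]
    push_cast
    ring
  have hcont : Continuous fun θ : ℝ =>
      ((lowestSpin s m : ℝ) * (lowestSpin s m + 1) - s ^ 2) * modeDensity s m P θ +
        Real.sin θ ^ 2 * modeDensity s m (derivative P) θ :=
    (continuous_const.mul (continuous_modeDensity s m P)).add
      ((Real.continuous_sin.pow 2).mul (continuous_modeDensity s m _))
  have hboundary : B.eval 1 - B.eval (-1) = 0 := by
    simp [hB]
  simp_rw [inner_modeL2_self, hpoint]
  rw [intervalIntegral.integral_sub, integral_derivative_eval_cos, hboundary,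
    intervalIntegral.integral_ofReal, sub_zero]
  · push_cast
    ring
  · exact (Complex.continuous_ofReal.comp hcont).intervalIntegrable _ _
  · exact ((continuous_eval_cos _).mul
      (Complex.continuous_ofReal.comp Real.continuous_sin)).intervalIntegrable _ _

theorem le_re_inner_modeL2_laplacianPoly_add {V : ℂ[X]} {δ : ℝ}
    (hV : ∀ x ∈ Icc (-1 : ℝ) 1,
      δ ≤ (lowestSpin s m : ℝ) * (lowestSpin s m + 1) - s ^ 2 + (V.eval (x : ℂ)).re) (P : ℂ[X]) :
    δ * ‖modeL2 s m P‖ ^ 2 ≤ (⟪modeL2 s m P, modeL2 s m (laplacianPoly s m P + V * P)⟫_ℂ).re := by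
  have hρ := continuous_modeDensity s m P
  have hρ' := continuous_modeDensity s m (derivative P)
  have hVc := continuous_eval_cos V
  have hre : (∫ θ in (0 : ℝ)..π, V.eval (Real.cos θ : ℂ) * modeDensity s m P θ).re =
      ∫ θ in (0 : ℝ)..π, (V.eval (Real.cos θ : ℂ)).re * modeDensity s m P θ := by
    rw [← RCLike.re_eq_complex_re, ← intervalIntegral.intervalIntegral_re]
    · simp only [RCLike.re_eq_complex_re, Complex.re_mul_ofReal]
    · exact (hVc.mul (Complex.continuous_ofReal.comp hρ)).intervalIntegrable _ _
  rw [map_add, inner_add_right, inner_modeL2_laplacianPoly, inner_modeL2_mul_self, Complex.add_re,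
    Complex.ofReal_re, show (2 * π : ℂ) = ((2 * π : ℝ) : ℂ) by push_cast; rfl,
    Complex.re_ofReal_mul, hre, ← mul_add, ← intervalIntegral.integral_add, norm_modeL2_sq,
    mul_left_comm, ← intervalIntegral.integral_const_mul]
  · refine mul_le_mul_of_nonneg_left (intervalIntegral.integral_mono_on Real.pi_pos.le
      (Continuous.intervalIntegrable (by fun_prop) _ _)
      (Continuous.intervalIntegrable ?_ _ _) fun θ hθ => ?_) (by positivity)
    · have := Complex.continuous_re.comp hVc
      exact .add (by fun_prop) (this.mul hρ)
    · have hle := mul_le_mul_of_nonneg_right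
        (hV (Real.cos θ) ⟨Real.neg_one_le_cos θ, Real.cos_le_one θ⟩) (modeDensity_nonneg s m P hθ)
      have hnonneg : 0 ≤ Real.sin θ ^ 2 * modeDensity s m (derivative P) θ :=
        mul_nonneg (sq_nonneg _) (modeDensity_nonneg s m _ hθ)
      linarith
  · exact Continuous.intervalIntegrable (by fun_prop) _ _
  · exact ((Complex.continuous_re.comp hVc).mul hρ).intervalIntegrable _ _

theorem im_inner_modeL2_laplacianPoly_add {V : ℂ[X]} {c : ℝ}
    (hV : ∀ x : ℝ, (V.eval (x : ℂ)).im = c) (P : ℂ[X]) :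
    (⟪modeL2 s m P, modeL2 s m (laplacianPoly s m P + V * P)⟫_ℂ).im = c * ‖modeL2 s m P‖ ^ 2 := by
  have him : (∫ θ in (0 : ℝ)..π, V.eval (Real.cos θ : ℂ) * modeDensity s m P θ).im =
      c * ∫ θ in (0 : ℝ)..π, modeDensity s m P θ := by
    rw [← RCLike.im_eq_complex_im, ← intervalIntegral.intervalIntegral_im,
      ← intervalIntegral.integral_const_mul]
    · simp only [RCLike.im_eq_complex_im, Complex.im_mul_ofReal, hV]
    · exact ((continuous_eval_cos V).mul (Complex.continuous_ofReal.comp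
        (continuous_modeDensity s m P))).intervalIntegrable _ _
  rw [map_add, inner_add_right, inner_modeL2_laplacianPoly, inner_modeL2_mul_self, Complex.add_im,
    Complex.ofReal_im, show (2 * π : ℂ) = ((2 * π : ℝ) : ℂ) by push_cast; rfl,
    Complex.im_ofReal_mul, him, norm_modeL2_sq]
  ring

variable (α ν : ℝ)

/-- The terms of order zero which `s² + α (1 - α/4 sin² θ) Z² + (ν + i α cos θ) Z` contributes in
the mode `m`, as a polynomial in `x = cos θ`. -/
def potentialPoly : ℂ[X] :=
  C ((s : ℂ) ^ 2) - C ((α * m ^ 2 : ℝ) : ℂ) * (1 - C ((α / 4 : ℝ) : ℂ) * (1 - X ^ 2)) -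
    C ((α * m : ℝ) : ℂ) * X + C (I * (ν * m : ℝ))

theorem eval_potentialPoly (x : ℝ) : (potentialPoly s m α ν).eval (x : ℂ) =
    ((s ^ 2 - α * m ^ 2 * (1 - α / 4 * (1 - x ^ 2)) - α * m * x : ℝ) : ℂ) + (ν * m : ℝ) * I := by
  simp only [potentialPoly, eval_add, eval_sub, eval_mul, eval_C, eval_one, eval_pow, eval_X]
  push_cast
  ring

/-- The operator `Δ + s² + α (1 - α/4 sin² θ) Z² + (ν + i α cos θ) Z`, with `Δ` the spin-`s`
Laplacian, acting on the polynomial part of the mode `m`. -/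
def angularPoly : ℂ[X] →ₗ[ℂ] ℂ[X] :=
  laplacianPoly s m + LinearMap.mulLeft ℂ (potentialPoly s m α ν)

theorem angularPoly_apply (P : ℂ[X]) :
    angularPoly s m α ν P = laplacianPoly s m P + potentialPoly s m α ν * P := rfl

variable {s m α ν}

theorem half_le_lowestSpin_add_re_potentialPoly (hs : s ≠ 0) (h : m = 0 ∨ α ≤ 1 / 4) {x : ℝ}
    (hx : x ∈ Icc (-1) 1) : 1 / 2 ≤ (lowestSpin s m : ℝ) * (lowestSpin s m + 1) - s ^ 2 +
      ((potentialPoly s m α ν).eval (x : ℂ)).re := by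
  have hl : (1 : ℝ) ≤ lowestSpin s m := by
    exact_mod_cast (Int.natAbs_pos.mpr hs).trans_le (le_max_right m.natAbs s.natAbs)
  have hm : |(m : ℝ)| ≤ lowestSpin s m := by
    rw [← Int.cast_abs, Int.abs_eq_natAbs]
    exact_mod_cast le_max_left m.natAbs s.natAbs
  rw [eval_potentialPoly, Complex.add_re, Complex.ofReal_re, Complex.re_ofReal_mul, Complex.I_re,
    mul_zero, add_zero]
  suffices hαm : α * (m ^ 2 + m * x) ≤ 1 / 4 * ((lowestSpin s m : ℝ) ^ 2 + lowestSpin s m) by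
    have : 0 ≤ (α * m) ^ 2 * (1 - x ^ 2) := mul_nonneg (sq_nonneg _) (by nlinarith [hx.1, hx.2])
    nlinarith
  rcases h with rfl | hα
  · rw [Int.cast_zero]
    nlinarith
  have hmx : |m * x| ≤ |(m : ℝ)| := by
    rw [abs_mul]
    exact mul_le_of_le_one_right (abs_nonneg _) (abs_le.mpr hx)
  have hsq : |(m : ℝ)| ≤ m ^ 2 := by
    rw [← Int.cast_abs, Int.abs_eq_natAbs]
    exact_mod_cast Int.natAbs_le_self_sq m
  have hnonneg : 0 ≤ m ^ 2 + m * x := by linarith [neg_le_of_abs_le hmx]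
  calc α * (m ^ 2 + m * x) ≤ 1 / 4 * (m ^ 2 + m * x) := by gcongr
    _ ≤ 1 / 4 * ((lowestSpin s m : ℝ) ^ 2 + lowestSpin s m) := by
      rw [← sq_abs (m : ℝ)]
      gcongr
      exact (le_abs_self _).trans (hmx.trans hm)

/-- For `m ≠ 0` and `|ν| ≥ 1/2` the imaginary part `m ν` of the potential is large; in the other
modes the real part of the form is coercive. -/
theorem half_mul_le_norm_inner_angularPoly (hs : s ≠ 0) (hα : α ≤ ν ^ 2) (P : ℂ[X]) :
    1 / 2 * ‖modeL2 s m P‖ ^ 2 ≤ ‖⟪modeL2 s m P, modeL2 s m (angularPoly s m α ν P)⟫_ℂ‖ := by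
  rw [angularPoly_apply]
  by_cases h : m = 0 ∨ |ν| ≤ 1 / 2
  · refine (le_re_inner_modeL2_laplacianPoly_add s m (fun x hx => ?_) P).trans
      (Complex.re_le_norm _)
    refine half_le_lowestSpin_add_re_potentialPoly hs (h.imp_right fun hν => hα.trans ?_) hx
    rw [← sq_abs]
    nlinarith [abs_nonneg ν]
  · push Not at h
    refine le_trans ?_ (Complex.abs_im_le_norm _)
    rw [im_inner_modeL2_laplacianPoly_add s m (c := ν * m) fun x => by
      simp only [eval_potentialPoly, Complex.add_im, Complex.ofReal_im, Complex.im_ofReal_mul,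
        Complex.I_im, zero_add, mul_one],
      abs_mul, abs_of_nonneg (sq_nonneg ‖modeL2 s m P‖), abs_mul]
    have hm : (1 : ℝ) ≤ |(m : ℝ)| := by exact_mod_cast Int.one_le_abs h.1
    gcongr
    nlinarith [h.2]

theorem inner_modeL2_eq_zero_of_angularPoly (hs : s ≠ 0) (hα : α ≤ ν ^ 2) {v : SphereL2}
    (hv : ∀ P, ⟪v, modeL2 s m (angularPoly s m α ν P)⟫_ℂ = 0) (P : ℂ[X]) :
    ⟪v, modeL2 s m P⟫_ℂ = 0 := by
  obtain ⟨K, hK⟩ := exists_norm_modeL2_mul_le s m (potentialPoly s m α ν)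
  refine inner_eq_zero_of_galerkin (modeL2 s m) (laplacianPoly s m)
    (LinearMap.mulLeft ℂ (potentialPoly s m α ν)) (K := degreeLT ℂ) (fun _ _ h => degreeLT_mono h)
    (fun n => (degreeLTEquiv ℂ n).symm.finiteDimensional)
    (fun Q => ⟨Q.natDegree + 1, ?_⟩) (fun n Q => laplacianPoly_mem_degreeLT s m)
    one_half_pos hK (half_mul_le_norm_inner_angularPoly hs hα) hv P
  rw [degreeLT_succ_eq_degreeLE, mem_degreeLE]
  exact degree_le_natDegree

end Coercivity

section Totality

theorem ae_mem_coordRect : ∀ᵐ x ∂sphereMeasure, x ∈ Ioo 0 π ×ˢ Ioo 0 (2 * π) := by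
  have hθ : ∀ᵐ θ ∂((volume.restrict (Ioo 0 π)).withDensity
      fun θ => ENNReal.ofReal (Real.sin θ)), θ ∈ Ioo 0 π :=
    (withDensity_absolutelyContinuous _ _).ae_le (ae_restrict_mem measurableSet_Ioo)
  have hφ : ∀ᵐ φ ∂(volume.restrict (Ioc 0 (2 * π))), φ ∈ Ioo 0 (2 * π) := by
    rw [← Measure.restrict_congr_set Ioo_ae_eq_Ioc]
    exact ae_restrict_mem measurableSet_Ioo
  unfold sphereMeasure
  filter_upwards [Measure.quasiMeasurePreserving_fst.ae hθ,
    Measure.quasiMeasurePreserving_snd.ae hφ] with x hx₁ hx₂ using ⟨hx₁, hx₂⟩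

/-- The closed coordinate rectangle of the sphere. -/
abbrev CoordRect : Type := Icc (0 : ℝ) π × Icc (0 : ℝ) (2 * π)

/-- The coordinates `(z, x + i y)` of the point of the unit sphere with angles `(θ, φ)`. -/
def spherePoint (x : CoordRect) : ℝ × ℂ :=
  (Real.cos x.1, Real.sin x.1 * Complex.exp (I * (x.2 : ℝ)))

theorem continuous_spherePoint : Continuous spherePoint := by
  unfold spherePoint
  fun_prop

theorem eq_of_exp_I_mul_eq {φ φ' : ℝ} (hφ : φ ∈ Ioo 0 (2 * π)) (hφ' : φ' ∈ Icc 0 (2 * π))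
    (h : Complex.exp (I * φ) = Complex.exp (I * φ')) : φ = φ' := by
  obtain ⟨n, hn⟩ := Complex.exp_eq_exp_iff_exists_int.mp h
  have hshift : φ = φ' + n * (2 * π) := by
    have : (φ : ℂ) = φ' + n * (2 * π) :=
      mul_left_cancel₀ Complex.I_ne_zero (by linear_combination hn)
    exact_mod_cast this
  have hlt : n < 1 := by
    by_contra! hc
    have : (1 : ℝ) ≤ n := by exact_mod_cast hc
    nlinarith [hφ.2, hφ'.1, Real.pi_pos]
  have hgt : -1 < n := by
    by_contra! hc
    have : (n : ℝ) ≤ -1 := by exact_mod_cast hc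
    nlinarith [hφ.1, hφ'.2, Real.pi_pos]
  obtain rfl : n = 0 := by omega
  simpa using hshift

theorem eq_of_spherePoint_eq {x y : CoordRect} (h : spherePoint x = spherePoint y)
    (hx : (x.1 : ℝ) ∈ Ioo 0 π ∧ (x.2 : ℝ) ∈ Ioo 0 (2 * π)) : x = y := by
  obtain ⟨⟨θ, hθ⟩, ⟨φ, hφ⟩⟩ := x
  obtain ⟨⟨θ', hθ'⟩, ⟨φ', hφ'⟩⟩ := y
  obtain ⟨hcos, hexp⟩ := Prod.ext_iff.mp h
  obtain rfl : θ = θ' := Real.injOn_cos hθ hθ' hcos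
  have hsin : (Real.sin θ : ℂ) ≠ 0 := mod_cast (Real.sin_pos_of_mem_Ioo hx.1).ne'
  obtain rfl : φ = φ' := eq_of_exp_I_mul_eq hx.2 hφ' (mul_left_cancel₀ hsin hexp)
  rfl

/-- The unit sphere, as the image of the coordinate rectangle. -/
abbrev SphereSet : Type := range spherePoint

/-- The projection of the coordinate rectangle onto the sphere. -/
def toSphere : C(CoordRect, SphereSet) :=
  ⟨rangeFactorization spherePoint, continuous_spherePoint.subtype_mk _⟩

instance : CompactSpace SphereSet :=
  isCompact_iff_compactSpace.mp (isCompact_range continuous_spherePoint)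

theorem isQuotientMap_toSphere : Topology.IsQuotientMap toSphere :=
  toSphere.continuous.isClosedMap.isQuotientMap toSphere.continuous rangeFactorization_surjective

theorem exists_continuousMap_sphere {g : ℝ × ℝ → ℂ} (hg : Continuous g)
    (hzero : ∀ x, x ∉ Ioo 0 π ×ˢ Ioo 0 (2 * π) → g x = 0) :
    ∃ G : C(SphereSet, ℂ), ∀ x : CoordRect, G (toSphere x) = g (x.1, x.2) := by
  let g' : C(CoordRect, ℂ) := ⟨fun x => g (x.1, x.2), by fun_prop⟩
  have hfactors : Function.FactorsThrough g' toSphere := by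
    intro x y hxy
    have hpoint : spherePoint x = spherePoint y := congrArg Subtype.val hxy
    by_cases hx : (x.1 : ℝ) ∈ Ioo 0 π ∧ (x.2 : ℝ) ∈ Ioo 0 (2 * π)
    · rw [eq_of_spherePoint_eq hpoint hx]
    by_cases hy : (y.1 : ℝ) ∈ Ioo 0 π ∧ (y.2 : ℝ) ∈ Ioo 0 (2 * π)
    · rw [eq_of_spherePoint_eq hpoint.symm hy]
    · exact (hzero (x.1, x.2) hx).trans (hzero (y.1, y.2) hy).symm
  exact ⟨isQuotientMap_toSphere.lift g' hfactors, fun x =>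
    DFunLike.congr_fun (isQuotientMap_toSphere.lift_comp g' hfactors) x⟩

/-- The point of the closed coordinate rectangle nearest to given angles. -/
def clampRect (x : ℝ × ℝ) : CoordRect :=
  (projIcc 0 π Real.pi_pos.le x.1, projIcc 0 (2 * π) Real.two_pi_pos.le x.2)

theorem continuous_clampRect : Continuous clampRect :=
  (continuous_projIcc.comp continuous_fst).prodMk (continuous_projIcc.comp continuous_snd)

theorem clampRect_of_mem {x : ℝ × ℝ} (hx : x ∈ Ioo 0 π ×ˢ Ioo 0 (2 * π)) :
    clampRect x = (⟨x.1, Ioo_subset_Icc_self hx.1⟩, ⟨x.2, Ioo_subset_Icc_self hx.2⟩) := by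
  rw [clampRect, projIcc_of_mem _ (Ioo_subset_Icc_self hx.1),
    projIcc_of_mem _ (Ioo_subset_Icc_self hx.2)]

/-- The coordinate `z` on the unit sphere. -/
def sphereHeight : C(SphereSet, ℂ) where
  toFun y := ((y : ℝ × ℂ).1 : ℂ)

/-- The coordinate `x + i y` on the unit sphere. -/
def spherePlanar : C(SphereSet, ℂ) where
  toFun y := (y : ℝ × ℂ).2

/-- The algebra of polynomial functions on the sphere. -/
def spherePolynomials : StarSubalgebra ℂ C(SphereSet, ℂ) :=
  StarAlgebra.adjoin ℂ {sphereHeight, spherePlanar}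

theorem topologicalClosure_spherePolynomials : spherePolynomials.topologicalClosure = ⊤ := by
  refine ContinuousMap.starSubalgebra_topologicalClosure_eq_top_of_separatesPoints _
    fun y y' hne => ?_
  have hsubset := StarAlgebra.subset_adjoin ℂ {sphereHeight, spherePlanar}
  by_cases h : (y : ℝ × ℂ).1 = (y' : ℝ × ℂ).1
  · exact ⟨_, ⟨_, hsubset (mem_insert_of_mem _ rfl), rfl⟩,
      fun hplanar => hne (Subtype.ext (Prod.ext h hplanar))⟩
  · exact ⟨_, ⟨_, hsubset (mem_insert _ _), rfl⟩,
      fun hheight => h (Complex.ofReal_injective hheight)⟩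

/-- The monomials in the functions `z`, `x + i y`, `x - i y` on the sphere. -/
def sphereMonomial (a b c : ℕ) : C(SphereSet, ℂ) :=
  sphereHeight ^ a * spherePlanar ^ b * star spherePlanar ^ c

theorem spherePolynomials_le_span {A : C(SphereSet, ℂ)} (hA : A ∈ spherePolynomials) :
    A ∈ Submodule.span ℂ {B | ∃ a b c, B = sphereMonomial a b c} := by
  have hstar : star sphereHeight = sphereHeight := by
    ext y
    exact Complex.conj_ofReal _
  have hA' : A ∈ Algebra.adjoin ℂ ({sphereHeight, spherePlanar} ∪
      star {sphereHeight, spherePlanar}) := hA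
  rw [← Subalgebra.mem_toSubmodule, Algebra.adjoin_eq_span] at hA'
  refine Submodule.span_mono (fun B hB => ?_) hA'
  induction hB using Submonoid.closure_induction with
  | mem B hB =>
    have hgen : B = sphereHeight ∨ B = spherePlanar ∨ B = star spherePlanar := by
      rcases hB with (h | h) | (h | h)
      · exact .inl h
      · exact .inr (.inl h)
      · exact .inl ((star_eq_iff_star_eq.mp h).symm.trans hstar)
      · exact .inr (.inr (star_eq_iff_star_eq.mp h).symm)
    rcases hgen with rfl | rfl | rfl
    · exact ⟨1, 0, 0, by simp [sphereMonomial]⟩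
    · exact ⟨0, 1, 0, by simp [sphereMonomial]⟩
    · exact ⟨0, 0, 1, by simp [sphereMonomial]⟩
  | one => exact ⟨0, 0, 0, by simp [sphereMonomial]⟩
  | mul B B' _ _ hB hB' =>
    obtain ⟨a, b, c, rfl⟩ := hB
    obtain ⟨a', b', c', rfl⟩ := hB'
    exact ⟨a + a', b + b', c + c', by simp only [sphereMonomial, pow_add]; ring⟩

theorem sphereMonomial_toSphere_clampRect (a b c : ℕ) {x : ℝ × ℝ}
    (hx : x ∈ Ioo 0 π ×ˢ Ioo 0 (2 * π)) :
    sphereMonomial a b c (toSphere (clampRect x)) = (Real.cos x.1 : ℂ) ^ a *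
      (Real.sin x.1 * Complex.exp (I * x.2)) ^ b *
        conj (Real.sin x.1 * Complex.exp (I * x.2)) ^ c := by
  rw [clampRect_of_mem hx]
  rfl

variable (s : ℤ)

/-- The mode `-s` of lowest order is a section of the spin-`s` bundle which vanishes only at the
south pole; its products with monomials on the sphere are modes. -/
theorem exists_modeFun_eq (a b c : ℕ) : ∃ (m : ℤ) (P : ℂ[X]), ∀ θ φ : ℝ,
    modeFun s m P θ φ = modeFun s (-s) 1 θ φ * ((Real.cos θ : ℂ) ^ a *
      (Real.sin θ * Complex.exp (I * φ)) ^ b * conj (Real.sin θ * Complex.exp (I * φ)) ^ c) := by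
  set m : ℤ := -s + b - c with hm
  obtain ⟨i, hi⟩ : ∃ i, b + c = northOrder s m + 2 * i :=
    ⟨min b c, by unfold northOrder; omega⟩
  obtain ⟨j, hj⟩ : ∃ j, southOrder s (-s) + (b + c) = southOrder s m + 2 * j := by
    refine ⟨(southOrder s (-s) + (b + c) - southOrder s m) / 2, ?_⟩
    unfold southOrder
    omega
  have hnorth : northOrder s (-s) = 0 := by simp [northOrder]
  refine ⟨m, C (2 ^ (b + c)) * X ^ a * (C (1 / 2) * (1 - X)) ^ i * (C (1 / 2) * (1 + X)) ^ j,
    fun θ φ => ?_⟩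
  have hexp : Complex.exp (I * m * φ) = Complex.exp (I * (-s : ℤ) * φ) *
      Complex.exp (I * φ) ^ b * conj (Complex.exp (I * φ)) ^ c := by
    rw [← Complex.exp_conj, ← Complex.exp_nat_mul, ← Complex.exp_nat_mul, ← Complex.exp_add,
      ← Complex.exp_add, map_mul, Complex.conj_I, Complex.conj_ofReal, hm]
    congr 1
    push_cast
    ring
  have hsin : (Real.sin θ : ℂ) = 2 * Real.sin (θ / 2) * Real.cos (θ / 2) := by
    exact_mod_cast congrArg Complex.ofReal
      (show Real.sin θ = 2 * Real.sin (θ / 2) * Real.cos (θ / 2) by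
        rw [← Real.sin_two_mul, mul_div_cancel₀ _ two_ne_zero])
  have hsin_pow : (Real.sin (θ / 2) : ℂ) ^ b * (Real.sin (θ / 2) : ℂ) ^ c =
      Real.sin (θ / 2) ^ northOrder s m * (Real.sin (θ / 2) ^ 2) ^ i := by
    rw [← pow_mul, ← pow_add, ← pow_add, hi]
  have hcos_pow : (Real.cos (θ / 2) : ℂ) ^ southOrder s (-s) *
      ((Real.cos (θ / 2) : ℂ) ^ b * (Real.cos (θ / 2) : ℂ) ^ c) =
      Real.cos (θ / 2) ^ southOrder s m * (Real.cos (θ / 2) ^ 2) ^ j := by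
    rw [← pow_mul, ← pow_add, ← pow_add, ← pow_add, hj]
  simp only [modeFun, modeProfile, hnorth, eval_mul, eval_C, eval_pow, eval_X, eval_add, eval_sub,
    eval_one, half_mul_one_sub_cos, half_mul_one_add_cos, map_mul, Complex.conj_ofReal,
    Complex.ofReal_mul, Complex.ofReal_pow, Complex.ofReal_one, pow_zero, hexp, hsin, map_ofNat]
  simp only [mul_pow, pow_add (2 : ℂ) b c]
  linear_combination -(Complex.exp (I * (-s : ℤ) * φ) *
    Complex.exp (I * φ) ^ b * conj (Complex.exp (I * φ)) ^ c * (2 ^ b * 2 ^ c) *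
    (Real.cos θ : ℂ) ^ a) * ((Real.sin (θ / 2) : ℂ) ^ b * (Real.sin (θ / 2) : ℂ) ^ c * hcos_pow +
      Real.cos (θ / 2) ^ southOrder s m * (Real.cos (θ / 2) ^ 2) ^ j * hsin_pow)

/-- The integral against `w` on the sphere, as a functional on the continuous functions on the
sphere. -/
def spherePairing {w : ℝ × ℝ → ℂ} (hw : Integrable w sphereMeasure) : C(SphereSet, ℂ) →L[ℂ] ℂ :=
  have hint (A : C(SphereSet, ℂ)) :
      Integrable (fun x => w x * A (toSphere (clampRect x))) sphereMeasure :=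
    hw.mul_bdd (A.continuous.comp
      (toSphere.continuous.comp continuous_clampRect)).aestronglyMeasurable
      (.of_forall fun _ => A.norm_coe_le_norm _)
  LinearMap.mkContinuous
    { toFun A := ∫ x, w x * A (toSphere (clampRect x)) ∂sphereMeasure
      map_add' A B := by
        simp only [ContinuousMap.add_apply, mul_add]
        exact integral_add (hint A) (hint B)
      map_smul' c A := by
        simp only [ContinuousMap.smul_apply, smul_eq_mul, mul_left_comm _ c]
        exact integral_const_mul _ _ }
    (∫ x, ‖w x‖ ∂sphereMeasure) fun A => by
      rw [← integral_mul_const]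
      refine norm_integral_le_of_norm_le (hw.norm.mul_const _) (.of_forall fun x => ?_)
      rw [norm_mul]
      gcongr
      exact A.norm_coe_le_norm _

theorem spherePairing_apply {w : ℝ × ℝ → ℂ} (hw : Integrable w sphereMeasure)
    (A : C(SphereSet, ℂ)) :
    spherePairing hw A = ∫ x, w x * A (toSphere (clampRect x)) ∂sphereMeasure := rfl

theorem spherePairing_eq_zero {w : ℝ × ℝ → ℂ} (hw : Integrable w sphereMeasure)
    (h : ∀ a b c, spherePairing hw (sphereMonomial a b c) = 0) : spherePairing hw = 0 := by
  have hpoly : (spherePolynomials : Set C(SphereSet, ℂ)) ⊆ (spherePairing hw).ker := fun A hA =>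
    Submodule.span_le.mpr (by rintro _ ⟨a, b, c, rfl⟩; exact h a b c) (spherePolynomials_le_span hA)
  have hclosure := closure_minimal hpoly (spherePairing hw).isClosed_ker
  ext A
  refine hclosure (show A ∈ spherePolynomials.topologicalClosure from ?_)
  rw [topologicalClosure_spherePolynomials]
  trivial

theorem ae_eq_zero_of_spherePairing_eq_zero {w : ℝ × ℝ → ℂ} (hw : Integrable w sphereMeasure)
    (h : spherePairing hw = 0) : ∀ᵐ x ∂sphereMeasure, w x = 0 := by
  have hrect : ∀ᵐ x ∂sphereMeasure, x ∈ Ioo 0 π ×ˢ Ioo 0 (2 * π) → w x = 0 := by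
    refine (isOpen_Ioo.prod isOpen_Ioo).ae_eq_zero_of_integral_contDiff_smul_eq_zero
      (hw.locallyIntegrable.locallyIntegrableOn _) fun g hg _ hsupp => ?_
    obtain ⟨G, hG⟩ := exists_continuousMap_sphere (g := fun x => (g x : ℂ))
      (Complex.continuous_ofReal.comp hg.continuous) fun x hx => by
        rw [image_eq_zero_of_notMem_tsupport fun hx' => hx (hsupp hx'), Complex.ofReal_zero]
    have hpairing : spherePairing hw G = 0 := by rw [h]; rfl
    rw [← hpairing, spherePairing_apply]
    refine integral_congr_ae ?_
    filter_upwards [ae_mem_coordRect] with x hx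
    rw [clampRect_of_mem hx, hG, Complex.real_smul, mul_comm]
  filter_upwards [hrect, ae_mem_coordRect] with x h hx using h hx

theorem modeFun_neg_spin_ne_zero {θ : ℝ} (hθ : θ ∈ Ioo 0 π) (φ : ℝ) :
    modeFun s (-s) 1 θ φ ≠ 0 := by
  have hsin : Real.sin (θ / 2) ≠ 0 :=
    (Real.sin_pos_of_mem_Ioo ⟨by linarith [hθ.1], by linarith [hθ.2, Real.pi_pos]⟩).ne'
  have hcos : Real.cos (θ / 2) ≠ 0 :=
    (Real.cos_pos_of_mem_Ioo ⟨by linarith [hθ.1, Real.pi_pos], by linarith [hθ.2]⟩).ne'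
  rw [modeFun, eval_one, mul_one, modeProfile]
  exact mul_ne_zero (Complex.exp_ne_zero _)
    (Complex.ofReal_ne_zero.mpr (mul_ne_zero (pow_ne_zero _ hsin) (pow_ne_zero _ hcos)))

theorem eq_zero_of_inner_modeL2_eq_zero {v : SphereL2}
    (hv : ∀ m P, ⟪v, modeL2 s m P⟫_ℂ = 0) : v = 0 := by
  obtain ⟨K, hK⟩ := exists_bound_modeFun s (-s) 1
  have hconj : Integrable (fun x => conj (v x)) sphereMeasure :=
    Complex.conjLIE.toContinuousLinearEquiv.toContinuousLinearMap.integrable_comp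
      ((Lp.memLp v).integrable one_le_two)
  have hw : Integrable (fun x => conj (v x) * modeFun s (-s) 1 x.1 x.2) sphereMeasure :=
    hconj.mul_bdd (continuous_modeFun s (-s) 1).aestronglyMeasurable (.of_forall fun x => hK _ _)
  have hpairing : spherePairing hw = 0 := spherePairing_eq_zero hw fun a b c => by
    obtain ⟨m, P, hP⟩ := exists_modeFun_eq s a b c
    rw [← hv m P, L2.inner_def, spherePairing_apply]
    refine integral_congr_ae ?_
    filter_upwards [coeFn_modeL2 s m P, ae_mem_coordRect] with x hmode hx
    rw [hmode, RCLike.inner_apply, hP, sphereMonomial_toSphere_clampRect a b c hx]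
    ring
  rw [Lp.eq_zero_iff_ae_eq_zero]
  filter_upwards [ae_eq_zero_of_spherePairing_eq_zero hw hpairing, ae_mem_coordRect] with x h hx
  simpa using (mul_eq_zero.mp h).resolve_right (modeFun_neg_spin_ne_zero s hx.1 x.2)

end Totality

section Calculus

/-- Joint smoothness on the coordinate strip `(a, b) × ℝ`. -/
def SmoothStrip (a b : ℝ) (f : ℝ → ℝ → ℂ) : Prop :=
  ContDiffOn ℝ ∞ (fun x : ℝ × ℝ => f x.1 x.2) (Ioo a b ×ˢ univ)

theorem isOpen_strip (a b : ℝ) : IsOpen (Ioo a b ×ˢ (univ : Set ℝ)) := isOpen_Ioo.prod isOpen_univ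

theorem contDiff_ofReal : ContDiff ℝ ∞ ((↑) : ℝ → ℂ) := Complex.ofRealCLM.contDiff

theorem contDiff_ofReal_sin : ContDiff ℝ ∞ fun θ : ℝ => (Real.sin θ : ℂ) :=
  contDiff_ofReal.comp Real.contDiff_sin

theorem dTheta_congr {a b : ℝ} {f g : ℝ → ℝ → ℂ} (h : ∀ θ ∈ Ioo a b, ∀ φ, f θ φ = g θ φ) {θ : ℝ}
    (hθ : θ ∈ Ioo a b) (φ : ℝ) : dTheta f θ φ = dTheta g θ φ :=
  EventuallyEq.deriv_eq (mem_of_superset (isOpen_Ioo.mem_nhds hθ) fun _ ht => h _ ht φ)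

namespace SmoothStrip

variable {a b : ℝ} {f g : ℝ → ℝ → ℂ}

theorem hasFDerivAt (hf : SmoothStrip a b f) {θ : ℝ} (hθ : θ ∈ Ioo a b) (φ : ℝ) :
    HasFDerivAt (fun x : ℝ × ℝ => f x.1 x.2)
      (fderiv ℝ (fun x : ℝ × ℝ => f x.1 x.2) (θ, φ)) (θ, φ) :=
  ((hf.contDiffAt ((isOpen_strip a b).mem_nhds ⟨hθ, mem_univ _⟩)).differentiableAt
    (by simp)).hasFDerivAt

theorem hasDerivAt_dTheta_fderiv (hf : SmoothStrip a b f) {θ : ℝ} (hθ : θ ∈ Ioo a b) (φ : ℝ) :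
    HasDerivAt (fun t => f t φ) (fderiv ℝ (fun x : ℝ × ℝ => f x.1 x.2) (θ, φ) (1, 0)) θ :=
  HasFDerivAt.comp_hasDerivAt (f := fun t : ℝ => (t, φ)) θ (hf.hasFDerivAt hθ φ)
    ((hasDerivAt_id θ).prodMk (hasDerivAt_const θ φ))

theorem hasDerivAt_Z_fderiv (hf : SmoothStrip a b f) {θ : ℝ} (hθ : θ ∈ Ioo a b) (φ : ℝ) :
    HasDerivAt (fun t => f θ t) (fderiv ℝ (fun x : ℝ × ℝ => f x.1 x.2) (θ, φ) (0, 1)) φ :=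
  HasFDerivAt.comp_hasDerivAt (f := fun t : ℝ => (θ, t)) φ (hf.hasFDerivAt hθ φ)
    ((hasDerivAt_const φ θ).prodMk (hasDerivAt_id φ))

theorem dTheta_eq (hf : SmoothStrip a b f) {θ : ℝ} (hθ : θ ∈ Ioo a b) (φ : ℝ) :
    dTheta f θ φ = fderiv ℝ (fun x : ℝ × ℝ => f x.1 x.2) (θ, φ) (1, 0) :=
  (hf.hasDerivAt_dTheta_fderiv hθ φ).deriv

theorem Z_eq (hf : SmoothStrip a b f) {θ : ℝ} (hθ : θ ∈ Ioo a b) (φ : ℝ) :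
    Z f θ φ = fderiv ℝ (fun x : ℝ × ℝ => f x.1 x.2) (θ, φ) (0, 1) :=
  (hf.hasDerivAt_Z_fderiv hθ φ).deriv

theorem hasDerivAt_dTheta (hf : SmoothStrip a b f) {θ : ℝ} (hθ : θ ∈ Ioo a b) (φ : ℝ) :
    HasDerivAt (fun t => f t φ) (dTheta f θ φ) θ := by
  rw [hf.dTheta_eq hθ]; exact hf.hasDerivAt_dTheta_fderiv hθ φ

theorem hasDerivAt_Z (hf : SmoothStrip a b f) {θ : ℝ} (hθ : θ ∈ Ioo a b) (φ : ℝ) :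
    HasDerivAt (fun t => f θ t) (Z f θ φ) φ := by
  rw [hf.Z_eq hθ]; exact hf.hasDerivAt_Z_fderiv hθ φ

theorem dTheta (hf : SmoothStrip a b f) : SmoothStrip a b (dTheta f) :=
  ((hf.fderiv_of_isOpen (isOpen_strip a b) (m := ∞) (by simp)).clm_apply
    (contDiffOn_const (c := ((1 : ℝ), (0 : ℝ))))).congr fun x hx => hf.dTheta_eq hx.1 x.2

theorem Z (hf : SmoothStrip a b f) : SmoothStrip a b (Z f) :=
  ((hf.fderiv_of_isOpen (isOpen_strip a b) (m := ∞) (by simp)).clm_apply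
    (contDiffOn_const (c := ((0 : ℝ), (1 : ℝ))))).congr fun x hx => hf.Z_eq hx.1 x.2

theorem mul (hf : SmoothStrip a b f) (hg : SmoothStrip a b g) :
    SmoothStrip a b fun θ φ => f θ φ * g θ φ :=
  ContDiffOn.mul hf hg

theorem add (hf : SmoothStrip a b f) (hg : SmoothStrip a b g) :
    SmoothStrip a b fun θ φ => f θ φ + g θ φ :=
  ContDiffOn.add hf hg

theorem sub (hf : SmoothStrip a b f) (hg : SmoothStrip a b g) :
    SmoothStrip a b fun θ φ => f θ φ - g θ φ :=
  ContDiffOn.sub hf hg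

theorem star (hf : SmoothStrip a b f) : SmoothStrip a b fun θ φ => conj (f θ φ) :=
  Complex.conjCLE.contDiff.comp_contDiffOn hf

theorem mono {c d : ℝ} (hf : SmoothStrip a b f) (h : Ioo c d ⊆ Ioo a b) : SmoothStrip c d f :=
  ContDiffOn.mono hf (prod_mono h subset_rfl)

theorem congr (hf : SmoothStrip a b f) (h : ∀ θ ∈ Ioo a b, ∀ φ, g θ φ = f θ φ) :
    SmoothStrip a b g :=
  ContDiffOn.congr hf fun x hx => h x.1 hx.1 x.2

theorem of_polar {c : ℝ → ℂ} (hc : ContDiffOn ℝ ∞ c (Ioo a b)) : SmoothStrip a b fun θ _ => c θ :=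
  hc.comp contDiff_fst.contDiffOn fun _ hx => hx.1

theorem sin : SmoothStrip a b fun θ _ => (Real.sin θ : ℂ) :=
  of_polar contDiff_ofReal_sin.contDiffOn

theorem exp (k : ℂ) : SmoothStrip a b fun _ φ => Complex.exp (k * φ) :=
  ((contDiff_const.mul contDiff_ofReal).cexp.comp contDiff_snd).contDiffOn

theorem exp_mul_comp {t : ℝ → ℝ} (ht : ContDiffOn ℝ ∞ t (Ioo a b)) {F : ℂ → ℂ}
    (hF : ContDiff ℝ ∞ F) (k : ℂ) :
    SmoothStrip a b fun θ φ => Complex.exp (k * φ) * F (t θ * Complex.exp (I * φ)) :=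
  (exp k).mul (hF.comp_contDiffOn ((of_polar (contDiff_ofReal.comp_contDiffOn ht)).mul (exp I)))

theorem exists_bound (hf : SmoothStrip a b f) {c d : ℝ} (h : Icc c d ⊆ Ioo a b) :
    ∃ K, ∀ θ ∈ Icc c d, ∀ φ ∈ Icc 0 (2 * π), ‖f θ φ‖ ≤ K := by
  obtain ⟨K, hK⟩ := (isCompact_Icc.prod
    (isCompact_Icc (a := 0) (b := 2 * π))).exists_bound_of_continuousOn
    (hf.continuousOn.mono (prod_mono h (subset_univ _)))
  exact ⟨K, fun θ hθ φ hφ => hK (θ, φ) ⟨hθ, hφ⟩⟩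

theorem dTheta_conj (hf : SmoothStrip a b f) {θ : ℝ} (hθ : θ ∈ Ioo a b) (φ : ℝ) :
    KerrHorizon.dTheta (fun t p => (starRingEnd ℂ) (f t p)) θ φ =
      (starRingEnd ℂ) (KerrHorizon.dTheta f θ φ) :=
  (hf.hasDerivAt_dTheta hθ φ).star.deriv

theorem Z_conj (hf : SmoothStrip a b f) {θ : ℝ} (hθ : θ ∈ Ioo a b) (φ : ℝ) :
    KerrHorizon.Z (fun t p => (starRingEnd ℂ) (f t p)) θ φ =
      (starRingEnd ℂ) (KerrHorizon.Z f θ φ) :=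
  (hf.hasDerivAt_Z hθ φ).star.deriv

theorem dTheta_add (hf : SmoothStrip a b f) (hg : SmoothStrip a b g) {θ : ℝ} (hθ : θ ∈ Ioo a b)
    (φ : ℝ) : KerrHorizon.dTheta (fun t p => f t p + g t p) θ φ =
      KerrHorizon.dTheta f θ φ + KerrHorizon.dTheta g θ φ :=
  ((hf.hasDerivAt_dTheta hθ φ).add (hg.hasDerivAt_dTheta hθ φ)).deriv

theorem Z_add (hf : SmoothStrip a b f) (hg : SmoothStrip a b g) {θ : ℝ} (hθ : θ ∈ Ioo a b)
    (φ : ℝ) : KerrHorizon.Z (fun t p => f t p + g t p) θ φ =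
      KerrHorizon.Z f θ φ + KerrHorizon.Z g θ φ :=
  ((hf.hasDerivAt_Z hθ φ).add (hg.hasDerivAt_Z hθ φ)).deriv

end SmoothStrip

/-- Smooth functions of `(θ, φ)` on the sphere minus its poles which are bounded together with
their polar derivative: what Green's identity requires of spin-weighted functions. -/
structure IsTame (f : ℝ → ℝ → ℂ) : Prop where
  smooth : SmoothStrip 0 π f
  bounded : ∃ K, ∀ θ ∈ Ioo 0 π, ∀ φ ∈ Icc 0 (2 * π), ‖f θ φ‖ ≤ K ∧ ‖dTheta f θ φ‖ ≤ K
  periodic : ∀ θ ∈ Ioo 0 π, ∀ φ, f θ (φ + 2 * π) = f θ φ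

namespace IsTame

variable {f : ℝ → ℝ → ℂ}

theorem Z_periodic (hf : IsTame f) {θ : ℝ} (hθ : θ ∈ Ioo 0 π) (φ : ℝ) :
    Z f θ (φ + 2 * π) = Z f θ φ := by
  unfold Z
  rw [← deriv_comp_add_const]
  congr 1
  exact funext fun t => hf.periodic θ hθ t

theorem star (hf : IsTame f) : IsTame fun θ φ => conj (f θ φ) where
  smooth := hf.smooth.star
  bounded := by
    obtain ⟨K, hK⟩ := hf.bounded
    refine ⟨K, fun θ hθ φ hφ => ?_⟩
    rw [hf.smooth.dTheta_conj hθ, RCLike.norm_conj, RCLike.norm_conj]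
    exact hK θ hθ φ hφ
  periodic θ hθ φ := by rw [hf.periodic θ hθ]

end IsTame

theorem exp_I_mul_add_two_pi (k : ℤ) (φ : ℝ) :
    Complex.exp (I * k * ((φ + 2 * π : ℝ) : ℂ)) = Complex.exp (I * k * φ) := by
  rw [show I * k * ((φ + 2 * π : ℝ) : ℂ) = I * k * φ + k * (2 * π * I) by push_cast; ring,
    Complex.exp_add, Complex.exp_int_mul_two_pi_mul_I, mul_one]

namespace IsSmoothSpinWeighted

variable {s : ℤ} {f g : ℝ → ℝ → ℂ}

theorem add (hf : IsSmoothSpinWeighted s f) (hg : IsSmoothSpinWeighted s g) :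
    IsSmoothSpinWeighted s fun θ φ => f θ φ + g θ φ := by
  obtain ⟨fN, fS, hfN, hfS, hf⟩ := hf
  obtain ⟨gN, gS, hgN, hgS, hg⟩ := hg
  refine ⟨fun z => fN z + gN z, fun z => fS z + gS z, hfN.add hgN, hfS.add hgS, fun θ hθ φ => ?_⟩
  rw [mul_add, mul_add, (hf θ hθ φ).1, (hf θ hθ φ).2, (hg θ hθ φ).1, (hg θ hθ φ).2]
  exact ⟨rfl, rfl⟩

theorem exists_north_extension (hf : IsSmoothSpinWeighted s f) :
    ∃ F : ℝ → ℝ → ℂ, SmoothStrip (-π) π F ∧ ∀ θ ∈ Ioo 0 π, ∀ φ, f θ φ = F θ φ := by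
  obtain ⟨gN, _, hN, _, h⟩ := hf
  refine ⟨_, .exp_mul_comp (t := fun θ => Real.tan (θ / 2)) (fun θ hθ => ?_) hN (-(I * s)),
    fun θ hθ φ => ?_⟩
  · have hcos : Real.cos (θ / 2) ≠ 0 :=
      (Real.cos_pos_of_mem_Ioo ⟨by linarith [hθ.1], by linarith [hθ.2]⟩).ne'
    exact ((Real.contDiffAt_tan.mpr hcos).comp θ (contDiffAt_id.div_const 2)).contDiffWithinAt
  · rw [← (h θ hθ φ).1, ← mul_assoc, ← Complex.exp_add]
    simp

theorem exists_south_extension (hf : IsSmoothSpinWeighted s f) :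
    ∃ F : ℝ → ℝ → ℂ, SmoothStrip 0 (2 * π) F ∧ ∀ θ ∈ Ioo 0 π, ∀ φ, f θ φ = F θ φ := by
  obtain ⟨_, gS, _, hS, h⟩ := hf
  refine ⟨_, .exp_mul_comp (t := fun θ => Real.cos (θ / 2) / Real.sin (θ / 2))
    (.div (by fun_prop) (by fun_prop) fun θ hθ => ?_) hS (I * s), fun θ hθ φ => ?_⟩
  · exact (Real.sin_pos_of_mem_Ioo ⟨by linarith [hθ.1], by linarith [hθ.2]⟩).ne'
  · rw [← inv_div, ← Real.tan_eq_sin_div_cos, Complex.ofReal_inv, ← (h θ hθ φ).2, ← mul_assoc,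
      ← Complex.exp_add]
    simp

theorem isTame (hf : IsSmoothSpinWeighted s f) : IsTame f where
  smooth := by
    obtain ⟨F, hF, hfF⟩ := hf.exists_north_extension
    exact (hF.mono (Ioo_subset_Ioo_left (by linarith [Real.pi_pos]))).congr hfF
  bounded := by
    obtain ⟨N, hN, hfN⟩ := hf.exists_north_extension
    obtain ⟨S, hS, hfS⟩ := hf.exists_south_extension
    have hnorth : Icc 0 (π / 2) ⊆ Ioo (-π) π :=
      Icc_subset_Ioo (by linarith [Real.pi_pos]) (by linarith [Real.pi_pos])
    have hsouth : Icc (π / 2) π ⊆ Ioo 0 (2 * π) :=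
      Icc_subset_Ioo (by linarith [Real.pi_pos]) (by linarith [Real.pi_pos])
    obtain ⟨K₁, hK₁⟩ := hN.exists_bound hnorth
    obtain ⟨K₂, hK₂⟩ := hN.dTheta.exists_bound hnorth
    obtain ⟨K₃, hK₃⟩ := hS.exists_bound hsouth
    obtain ⟨K₄, hK₄⟩ := hS.dTheta.exists_bound hsouth
    refine ⟨max (max K₁ K₂) (max K₃ K₄), fun θ hθ φ hφ => ?_⟩
    rcases le_total θ (π / 2) with hle | hle
    · have hθ' : θ ∈ Icc 0 (π / 2) := ⟨hθ.1.le, hle⟩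
      rw [dTheta_congr hfN hθ, hfN θ hθ]
      exact ⟨(hK₁ θ hθ' φ hφ).trans (by simp), (hK₂ θ hθ' φ hφ).trans (by simp)⟩
    · have hθ' : θ ∈ Icc (π / 2) π := ⟨hle, hθ.2.le⟩
      rw [dTheta_congr hfS hθ, hfS θ hθ]
      exact ⟨(hK₃ θ hθ' φ hφ).trans (by simp), (hK₄ θ hθ' φ hφ).trans (by simp)⟩
  periodic θ hθ φ := by
    obtain ⟨gN, _, _, _, h⟩ := hf
    have hexp := exp_I_mul_add_two_pi 1 φ
    rw [Int.cast_one, mul_one] at hexp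
    have hshift := (h θ hθ (φ + 2 * π)).1
    rw [exp_I_mul_add_two_pi, hexp, ← (h θ hθ φ).1] at hshift
    exact mul_left_cancel₀ (Complex.exp_ne_zero _) hshift

end IsSmoothSpinWeighted

end Calculus

section Green

/-- The operator `-(1/sin θ) ∂_θ (sin θ ∂_θ) + c₂ Z² + c₁ Z + c₀` with coefficients depending on
`θ`. -/
def axisymmetricExpr (c₂ c₁ c₀ : ℝ → ℂ) (f : ℝ → ℝ → ℂ) (θ φ : ℝ) : ℂ :=
  -(1 / (Real.sin θ : ℂ)) * dTheta (fun t p => (Real.sin t : ℂ) * dTheta f t p) θ φ +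
    c₂ θ * Z (Z f) θ φ + c₁ θ * Z f θ φ + c₀ θ * f θ φ

/-- The polar component of the flux in Green's identity. -/
def polarFlux (f g : ℝ → ℝ → ℂ) (θ φ : ℝ) : ℂ :=
  f θ φ * ((Real.sin θ : ℂ) * dTheta g θ φ) - g θ φ * ((Real.sin θ : ℂ) * dTheta f θ φ)

/-- The azimuthal component of the flux in Green's identity. -/
def azimuthalFlux (c₂ c₁ : ℝ → ℂ) (f g : ℝ → ℝ → ℂ) (θ φ : ℝ) : ℂ :=
  (Real.sin θ : ℂ) * c₂ θ * (g θ φ * Z f θ φ - f θ φ * Z g θ φ) +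
    (Real.sin θ : ℂ) * c₁ θ * (g θ φ * f θ φ)

variable {f g : ℝ → ℝ → ℂ} {c₂ c₁ c₀ : ℝ → ℂ}

theorem axisymmetricExpr_add {a b : ℝ} (hf : SmoothStrip a b f) (hg : SmoothStrip a b g) {θ : ℝ}
    (hθ : θ ∈ Ioo a b) (φ : ℝ) :
    axisymmetricExpr c₂ c₁ c₀ (fun t p => f t p + g t p) θ φ =
      axisymmetricExpr c₂ c₁ c₀ f θ φ + axisymmetricExpr c₂ c₁ c₀ g θ φ := by
  have hpolar : dTheta (fun t p => (Real.sin t : ℂ) * dTheta (fun t p => f t p + g t p) t p) θ φ =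
      dTheta (fun t p => (Real.sin t : ℂ) * dTheta f t p) θ φ +
        dTheta (fun t p => (Real.sin t : ℂ) * dTheta g t p) θ φ := by
    rw [← (SmoothStrip.sin.mul hf.dTheta).dTheta_add (SmoothStrip.sin.mul hg.dTheta) hθ]
    exact dTheta_congr (fun t ht p => by rw [hf.dTheta_add hg ht, mul_add]) hθ φ
  have hZZ : Z (Z (fun t p => f t p + g t p)) θ φ = Z (Z f) θ φ + Z (Z g) θ φ := by
    rw [← hf.Z.Z_add hg.Z hθ]
    exact congrArg (deriv · φ) (funext fun p => hf.Z_add hg hθ p)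
  simp only [axisymmetricExpr, hpolar, hZZ, hf.Z_add hg hθ]
  ring

theorem conj_axisymmetricExpr {a b : ℝ} (hf : SmoothStrip a b f) {θ : ℝ} (hθ : θ ∈ Ioo a b)
    (φ : ℝ) : conj (axisymmetricExpr c₂ c₁ c₀ f θ φ) =
      axisymmetricExpr (conj c₂) (conj c₁) (conj c₀) (fun t p => conj (f t p)) θ φ := by
  have hpolar : dTheta (fun t p => (Real.sin t : ℂ) * dTheta (fun t p => conj (f t p)) t p) θ φ =
      conj (dTheta (fun t p => (Real.sin t : ℂ) * dTheta f t p) θ φ) := by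
    rw [← (SmoothStrip.sin.mul hf.dTheta).dTheta_conj hθ]
    exact dTheta_congr (fun t ht p => by rw [hf.dTheta_conj ht, map_mul, Complex.conj_ofReal]) hθ φ
  have hZZ : Z (Z (fun t p => conj (f t p))) θ φ = conj (Z (Z f) θ φ) := by
    rw [← hf.Z.Z_conj hθ]
    exact congrArg (deriv · φ) (funext fun p => hf.Z_conj hθ p)
  simp only [axisymmetricExpr, hpolar, hZZ, hf.Z_conj hθ, map_add, map_mul, map_neg, map_div₀,
    map_one, Complex.conj_ofReal]
  rfl

theorem smoothStrip_polarFlux {a b : ℝ} (hf : SmoothStrip a b f) (hg : SmoothStrip a b g) :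
    SmoothStrip a b (polarFlux f g) :=
  (hf.mul (SmoothStrip.sin.mul hg.dTheta)).sub (hg.mul (SmoothStrip.sin.mul hf.dTheta))

theorem smoothStrip_azimuthalFlux {a b : ℝ} (hf : SmoothStrip a b f) (hg : SmoothStrip a b g)
    (h₂ : ContDiffOn ℝ ∞ c₂ (Ioo a b)) (h₁ : ContDiffOn ℝ ∞ c₁ (Ioo a b)) :
    SmoothStrip a b (azimuthalFlux c₂ c₁ f g) :=
  ((SmoothStrip.sin.mul (.of_polar h₂)).mul ((hg.mul hf.Z).sub (hf.mul hg.Z))).add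
    ((SmoothStrip.sin.mul (.of_polar h₁)).mul (hg.mul hf))

theorem divergence_flux (hf : SmoothStrip 0 π f) (hg : SmoothStrip 0 π g) {θ : ℝ}
    (hθ : θ ∈ Ioo 0 π) (φ : ℝ) :
    dTheta (polarFlux f g) θ φ + Z (azimuthalFlux c₂ c₁ f g) θ φ =
      (Real.sin θ : ℂ) * (g θ φ * axisymmetricExpr c₂ c₁ c₀ f θ φ -
        f θ φ * axisymmetricExpr c₂ (-c₁) c₀ g θ φ) := by
  have hsin : (Real.sin θ : ℂ) ≠ 0 := by exact_mod_cast (Real.sin_pos_of_mem_Ioo hθ).ne'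
  have hpolar : dTheta (polarFlux f g) θ φ = _ :=
    (((hf.hasDerivAt_dTheta hθ φ).mul
      ((SmoothStrip.sin.mul hg.dTheta).hasDerivAt_dTheta hθ φ)).sub
      ((hg.hasDerivAt_dTheta hθ φ).mul
        ((SmoothStrip.sin.mul hf.dTheta).hasDerivAt_dTheta hθ φ))).deriv
  have hazimuthal : Z (azimuthalFlux c₂ c₁ f g) θ φ = _ :=
    (((((hg.hasDerivAt_Z hθ φ).mul (hf.Z.hasDerivAt_Z hθ φ)).sub
      ((hf.hasDerivAt_Z hθ φ).mul (hg.Z.hasDerivAt_Z hθ φ))).const_mul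
        ((Real.sin θ : ℂ) * c₂ θ)).add
      (((hg.hasDerivAt_Z hθ φ).mul (hf.hasDerivAt_Z hθ φ)).const_mul
        ((Real.sin θ : ℂ) * c₁ θ))).deriv
  rw [hpolar, hazimuthal]
  simp only [axisymmetricExpr, Pi.neg_apply]
  field_simp
  ring

theorem azimuthalFlux_two_pi (hf : IsTame f) (hg : IsTame g) {θ : ℝ} (hθ : θ ∈ Ioo 0 π) :
    azimuthalFlux c₂ c₁ f g θ (2 * π) = azimuthalFlux c₂ c₁ f g θ 0 := by
  have hfper := hf.periodic θ hθ 0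
  have hgper := hg.periodic θ hθ 0
  have hZfper := hf.Z_periodic hθ 0
  have hZgper := hg.Z_periodic hθ 0
  rw [zero_add] at hfper hgper hZfper hZgper
  simp only [azimuthalFlux, hfper, hgper, hZfper, hZgper]

theorem integral_divergence_flux (hf : IsTame f) (hg : IsTame g)
    (h₂ : ContDiffOn ℝ ∞ c₂ (Ioo 0 π)) (h₁ : ContDiffOn ℝ ∞ c₁ (Ioo 0 π)) {c d : ℝ}
    (hc : c ∈ Ioo 0 π) (hd : d ∈ Ioo 0 π) :
    (∫ θ in c..d, ∫ φ in (0 : ℝ)..2 * π,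
      (dTheta (polarFlux f g) θ φ + Z (azimuthalFlux c₂ c₁ f g) θ φ)) =
      (∫ φ in (0 : ℝ)..2 * π, polarFlux f g d φ) - ∫ φ in (0 : ℝ)..2 * π, polarFlux f g c φ := by
  have hA := smoothStrip_polarFlux hf.smooth hg.smooth
  have hB := smoothStrip_azimuthalFlux hf.smooth hg.smooth h₂ h₁
  have hsub : uIcc c d ⊆ Ioo 0 π := ordConnected_Ioo.uIcc_subset hc hd
  have hsub' : Ioo (min c d) (max c d) ⊆ Ioo 0 π := Ioo_subset_Icc_self.trans hsub
  have hsq : uIcc c d ×ˢ uIcc 0 (2 * π) ⊆ Ioo 0 π ×ˢ univ := prod_mono hsub (subset_univ _)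
  have hdiv : ContinuousOn (fun x : ℝ × ℝ => fderiv ℝ (fun x : ℝ × ℝ => polarFlux f g x.1 x.2) x
      (1, 0) + fderiv ℝ (fun x : ℝ × ℝ => azimuthalFlux c₂ c₁ f g x.1 x.2) x (0, 1))
      (uIcc c d ×ˢ uIcc 0 (2 * π)) := by
    refine ((hA.dTheta.add hB.Z).continuousOn.mono hsq).congr fun x hx => ?_
    beta_reduce
    rw [hA.dTheta_eq (hsq hx).1, hB.Z_eq (hsq hx).1]
  have hdivergence := integral2_divergence_prod_of_hasFDerivAt
    (fun x : ℝ × ℝ => polarFlux f g x.1 x.2) (fun x : ℝ × ℝ => azimuthalFlux c₂ c₁ f g x.1 x.2)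
    (fderiv ℝ fun x : ℝ × ℝ => polarFlux f g x.1 x.2)
    (fderiv ℝ fun x : ℝ × ℝ => azimuthalFlux c₂ c₁ f g x.1 x.2) c 0 d (2 * π)
    (hA.continuousOn.mono hsq) (hB.continuousOn.mono hsq)
    (fun x hx => hA.hasFDerivAt (hsub' hx.1) x.2) (fun x hx => hB.hasFDerivAt (hsub' hx.1) x.2)
    (hdiv.integrableOn_compact (isCompact_uIcc.prod isCompact_uIcc))
  simp only at hdivergence
  rw [intervalIntegral.integral_congr fun θ hθ => azimuthalFlux_two_pi hf hg (hsub hθ), sub_self,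
    zero_add] at hdivergence
  rw [← hdivergence]
  refine intervalIntegral.integral_congr fun θ hθ => intervalIntegral.integral_congr fun φ _ => ?_
  rw [hA.dTheta_eq (hsub hθ), hB.Z_eq (hsub hθ)]

theorem exists_bound_integral_polarFlux (hf : IsTame f) (hg : IsTame g) :
    ∃ K, ∀ θ ∈ Ioo 0 π, ‖∫ φ in (0 : ℝ)..2 * π, polarFlux f g θ φ‖ ≤ K * Real.sin θ := by
  obtain ⟨C, hC⟩ := hf.bounded
  obtain ⟨D, hD⟩ := hg.bounded
  refine ⟨2 * (C * D) * (2 * π), fun θ hθ => ?_⟩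
  have hsin : 0 < Real.sin θ := Real.sin_pos_of_mem_Ioo hθ
  have hbound : ∀ φ ∈ uIoc 0 (2 * π), ‖polarFlux f g θ φ‖ ≤ 2 * (C * D) * Real.sin θ := by
    intro φ hφ
    rw [uIoc_of_le Real.two_pi_pos.le] at hφ
    obtain ⟨hf₀, hf₁⟩ := hC θ hθ φ (Ioc_subset_Icc_self hφ)
    obtain ⟨hg₀, hg₁⟩ := hD θ hθ φ (Ioc_subset_Icc_self hφ)
    have hC₀ : 0 ≤ C := (norm_nonneg _).trans hf₀
    have hD₀ : 0 ≤ D := (norm_nonneg _).trans hg₀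
    calc ‖polarFlux f g θ φ‖ ≤ ‖f θ φ‖ * (Real.sin θ * ‖dTheta g θ φ‖) +
          ‖g θ φ‖ * (Real.sin θ * ‖dTheta f θ φ‖) := by
          refine (norm_sub_le _ _).trans_eq ?_
          simp only [norm_mul, Complex.norm_real, Real.norm_of_nonneg hsin.le]
      _ ≤ C * (Real.sin θ * D) + D * (Real.sin θ * C) := by gcongr
      _ = 2 * (C * D) * Real.sin θ := by ring
  refine (intervalIntegral.norm_integral_le_of_norm_le_const hbound).trans_eq ?_
  rw [sub_zero, abs_of_pos Real.two_pi_pos]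
  ring

variable {D : ℝ → ℝ → ℂ}

theorem sin_smul_integral {θ : ℝ} (hθ : θ ∈ Ioo 0 π) :
    (ENNReal.ofReal (Real.sin θ)).toReal • ∫ φ in Ioc 0 (2 * π), D θ φ =
      ∫ φ in (0 : ℝ)..2 * π, (Real.sin θ : ℂ) * D θ φ := by
  rw [ENNReal.toReal_ofReal (Real.sin_pos_of_mem_Ioo hθ).le, Complex.real_smul,
    intervalIntegral.integral_const_mul, intervalIntegral.integral_of_le Real.two_pi_pos.le]

theorem integrableOn_integral_sin_mul
    (hD : Integrable (fun x : ℝ × ℝ => D x.1 x.2) sphereMeasure) :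
    IntegrableOn (fun θ => ∫ φ in (0 : ℝ)..2 * π, (Real.sin θ : ℂ) * D θ φ) (Ioo 0 π) := by
  refine ((integrable_withDensity_iff_integrable_smul' (by fun_prop) (by simp)).mp
    hD.integral_prod_left).congr ?_
  filter_upwards [ae_restrict_mem measurableSet_Ioo] with θ hθ using sin_smul_integral hθ

theorem integral_sphereMeasure
    (hD : Integrable (fun x : ℝ × ℝ => D x.1 x.2) sphereMeasure) :
    ∫ x, D x.1 x.2 ∂sphereMeasure =
      ∫ θ in Ioo 0 π, ∫ φ in (0 : ℝ)..2 * π, (Real.sin θ : ℂ) * D θ φ := by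
  rw [sphereMeasure, integral_prod _ hD,
    integral_withDensity_eq_integral_toReal_smul (by fun_prop) (by simp)]
  exact setIntegral_congr_fun measurableSet_Ioo fun θ hθ => sin_smul_integral hθ

theorem tendsto_sphere_integral
    (hD : Integrable (fun x : ℝ × ℝ => D x.1 x.2) sphereMeasure) :
    Tendsto (fun ε : ℝ => ∫ θ in ε..(π - ε), ∫ φ in (0 : ℝ)..2 * π, (Real.sin θ : ℂ) * D θ φ)
      (𝓝[>] 0) (𝓝 (∫ x, D x.1 x.2 ∂sphereMeasure)) := by
  have hnorth : Tendsto (fun ε : ℝ => ε) (𝓝[>] 0) (𝓝 0) := nhdsWithin_le_nhds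
  have hsouth : Tendsto (fun ε : ℝ => π - ε) (𝓝[>] 0) (𝓝 π) := by
    simpa using hnorth.const_sub π
  rw [integral_sphereMeasure hD]
  refine ((aecover_Ioo_of_Ioc hnorth hsouth).integral_tendsto_of_countably_generated
    (integrableOn_integral_sin_mul hD)).congr' ?_
  filter_upwards [Ioo_mem_nhdsGT (half_pos Real.pi_pos)] with ε hε
  have hsub : Ioc ε (π - ε) ⊆ Ioo 0 π :=
    fun θ hθ => ⟨hε.1.trans hθ.1, by linarith [hθ.2, hε.1]⟩
  rw [intervalIntegral.integral_of_le (by linarith [hε.2]),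
    Measure.restrict_restrict_of_subset hsub]

theorem green_identity (hf : IsTame f) (hg : IsTame g)
    (h₂ : ContDiffOn ℝ ∞ c₂ (Ioo 0 π)) (h₁ : ContDiffOn ℝ ∞ c₁ (Ioo 0 π))
    (hint : Integrable (fun x : ℝ × ℝ => g x.1 x.2 * axisymmetricExpr c₂ c₁ c₀ f x.1 x.2 -
      f x.1 x.2 * axisymmetricExpr c₂ (-c₁) c₀ g x.1 x.2) sphereMeasure) :
    ∫ x, (g x.1 x.2 * axisymmetricExpr c₂ c₁ c₀ f x.1 x.2 -
      f x.1 x.2 * axisymmetricExpr c₂ (-c₁) c₀ g x.1 x.2) ∂sphereMeasure = 0 := by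
  obtain ⟨K, hK⟩ := exists_bound_integral_polarFlux hf hg
  have hflux : Tendsto (fun ε : ℝ => K * Real.sin (π - ε) + K * Real.sin ε) (𝓝[>] 0) (𝓝 0) := by
    have hcont : Continuous fun ε : ℝ => K * Real.sin (π - ε) + K * Real.sin ε := by fun_prop
    simpa using (hcont.tendsto 0).mono_left nhdsWithin_le_nhds
  refine tendsto_nhds_unique (tendsto_sphere_integral (D := fun θ φ =>
    g θ φ * axisymmetricExpr c₂ c₁ c₀ f θ φ - f θ φ * axisymmetricExpr c₂ (-c₁) c₀ g θ φ) hint)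
    (squeeze_zero_norm' ?_ hflux)
  filter_upwards [Ioo_mem_nhdsGT Real.pi_pos] with ε hε
  have hε' : π - ε ∈ Ioo 0 π := ⟨by linarith [hε.2], by linarith [hε.1]⟩
  have hsub : uIcc ε (π - ε) ⊆ Ioo 0 π := ordConnected_Ioo.uIcc_subset hε hε'
  rw [intervalIntegral.integral_congr fun θ hθ => intervalIntegral.integral_congr fun φ _ =>
    (divergence_flux hf.smooth hg.smooth (hsub hθ) φ).symm,
    integral_divergence_flux hf hg h₂ h₁ hε hε']
  exact (norm_sub_le _ _).trans (add_le_add (hK _ hε') (hK _ hε))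

end Green

section ModeAction

/-- The differential expression `Δ + s² + α (1 - α/4 sin² θ) Z² + (ν + i α cos θ) Z`, with `Δ` the
spin-`s` Laplacian. The horizon expression is the case `s = -1`, `α = a²/(M r₊)`, `ν = a/M`. -/
def angularExpr (s : ℤ) (α ν : ℝ) (f : ℝ → ℝ → ℂ) (θ φ : ℝ) : ℂ :=
  spinLaplacian s f θ φ + s ^ 2 * f θ φ +
    ((α * (1 - α / 4 * Real.sin θ ^ 2) : ℝ) : ℂ) * Z (Z f) θ φ +
    (ν + I * α * Real.cos θ) * Z f θ φ

theorem differentiable_modeProfile (s m : ℤ) : Differentiable ℝ (modeProfile s m) := by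
  unfold modeProfile
  fun_prop

theorem deriv_modeProfile (s m : ℤ) (θ : ℝ) : deriv (modeProfile s m) θ =
    northOrder s m * Real.sin (θ / 2) ^ (northOrder s m - 1) * (Real.cos (θ / 2) / 2) *
        Real.cos (θ / 2) ^ southOrder s m -
      Real.sin (θ / 2) ^ northOrder s m *
        (southOrder s m * Real.cos (θ / 2) ^ (southOrder s m - 1) * (Real.sin (θ / 2) / 2)) := by
  have hhalf : HasDerivAt (fun t : ℝ => t / 2) (1 / 2) θ := (hasDerivAt_id θ).div_const 2
  have hprofile : HasDerivAt (modeProfile s m) _ θ :=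
    (hhalf.sin.pow (northOrder s m)).mul (hhalf.cos.pow (southOrder s m))
  rw [hprofile.deriv, Pi.pow_apply]
  ring

theorem sin_mul_deriv_modeProfile (s m : ℤ) (θ : ℝ) :
    (Real.sin θ : ℂ) * (deriv (modeProfile s m) θ : ℝ) =
      (driftPoly s m).eval (Real.cos θ : ℂ) * modeProfile s m θ := by
  have hsin : Real.sin θ = 2 * Real.sin (θ / 2) * Real.cos (θ / 2) := by
    rw [← Real.sin_two_mul, mul_div_cancel₀ _ two_ne_zero]
  have hreal : Real.sin θ * deriv (modeProfile s m) θ =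
      (northOrder s m * Real.cos (θ / 2) ^ 2 - southOrder s m * Real.sin (θ / 2) ^ 2) *
        modeProfile s m θ := by
    rw [deriv_modeProfile, hsin, modeProfile]
    linear_combination
      Real.cos (θ / 2) ^ 2 * Real.cos (θ / 2) ^ southOrder s m *
          natCast_mul_pow_sub_one_mul (northOrder s m) (Real.sin (θ / 2)) -
        Real.sin (θ / 2) ^ 2 * Real.sin (θ / 2) ^ northOrder s m *
          natCast_mul_pow_sub_one_mul (southOrder s m) (Real.cos (θ / 2))
  have hcos : (Real.cos (θ / 2) : ℂ) ^ 2 = 1 / 2 * (1 + Real.cos θ) :=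
    (half_mul_one_add_cos θ).symm
  have hsin' : (Real.sin (θ / 2) : ℂ) ^ 2 = 1 / 2 * (1 - Real.cos θ) :=
    (half_mul_one_sub_cos θ).symm
  rw [← Complex.ofReal_mul, hreal, driftPoly]
  push_cast [-Complex.ofReal_sin, -Complex.ofReal_cos]
  rw [hcos, hsin', eval_add, eval_mul, eval_C, eval_C, eval_X]
  linear_combination modeProfile s m θ * Real.cos θ / 2 * northOrder_add_southOrder_cast s m

theorem sin_mul_dTheta_modeFun (s m : ℤ) (P : ℂ[X]) (θ φ : ℝ) :
    (Real.sin θ : ℂ) * dTheta (modeFun s m P) θ φ = modeFun s m (polarPoly s m P) θ φ := by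
  have hP : HasDerivAt (fun t : ℝ => P.eval (Real.cos t : ℂ))
      ((derivative P).eval (Real.cos θ : ℂ) * ((-Real.sin θ : ℝ) : ℂ)) θ :=
    HasDerivAt.comp (h₂ := fun z => P.eval z) θ (P.hasDerivAt (Real.cos θ : ℂ))
      (Real.hasDerivAt_cos θ).ofReal_comp
  have hmode : dTheta (modeFun s m P) θ φ = _ :=
    (((differentiable_modeProfile s m θ).hasDerivAt.ofReal_comp.mul hP).const_mul
      (Complex.exp (I * m * φ))).deriv
  have hsin : (Real.sin θ : ℂ) ^ 2 = 1 - (Real.cos θ : ℂ) ^ 2 := mod_cast Real.sin_sq θ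
  rw [hmode, Complex.ofReal_neg]
  simp only [modeFun, polarPoly, eval_sub, eval_mul, eval_one, eval_pow, eval_X]
  linear_combination
    Complex.exp (I * m * φ) * P.eval (Real.cos θ : ℂ) * sin_mul_deriv_modeProfile s m θ -
      Complex.exp (I * m * φ) * modeProfile s m θ * (derivative P).eval (Real.cos θ : ℂ) * hsin

theorem Z_modeFun (s m : ℤ) (P : ℂ[X]) :
    Z (modeFun s m P) = modeFun s m (C (I * m) * P) := by
  ext θ φ
  have hexp : HasDerivAt (fun t : ℝ => I * m * (t : ℂ)) (I * m * 1) φ :=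
    (hasDerivAt_id φ).ofReal_comp.const_mul _
  have hmode : Z (modeFun s m P) θ φ = _ := (hexp.cexp.mul_const _).deriv
  rw [hmode, modeFun, eval_mul, eval_C]
  ring

theorem spinLaplacian_modeFun (s m : ℤ) (P : ℂ[X]) {θ : ℝ} (hθ : θ ∈ Ioo 0 π) (φ : ℝ) :
    spinLaplacian s (modeFun s m P) θ φ = modeFun s m (laplacianPoly s m P) θ φ := by
  have hsin : (Real.sin θ : ℂ) ≠ 0 := by exact_mod_cast (Real.sin_pos_of_mem_Ioo hθ).ne'
  have hsq : (Real.sin θ : ℂ) ^ 2 = 1 - (Real.cos θ : ℂ) ^ 2 := mod_cast Real.sin_sq θ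
  have hpolar : (fun t p => (Real.sin t : ℂ) * dTheta (modeFun s m P) t p) =
      modeFun s m (polarPoly s m P) :=
    funext fun t => funext fun p => sin_mul_dTheta_modeFun s m P t p
  have hpolar₂ : dTheta (modeFun s m (polarPoly s m P)) θ φ =
      modeFun s m (polarPoly s m (polarPoly s m P)) θ φ / Real.sin θ :=
    eq_div_of_mul_eq hsin ((mul_comm _ _).trans (sin_mul_dTheta_modeFun s m _ θ φ))
  rw [spinLaplacian, hpolar, hpolar₂, polarPoly_polarPoly, Z_modeFun, Z_modeFun]
  simp only [modeFun, eval_sub, eval_add, eval_mul, eval_pow, eval_C, eval_X, eval_one, ← hsq]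
  field_simp
  linear_combination -(modeProfile s m θ * (m ^ 2 + 2 * m * s * Real.cos θ) *
    P.eval (Real.cos θ : ℂ)) * Complex.I_sq

theorem angularExpr_modeFun (s m : ℤ) (α ν : ℝ) (P : ℂ[X]) {θ : ℝ} (hθ : θ ∈ Ioo 0 π) (φ : ℝ) :
    angularExpr s α ν (modeFun s m P) θ φ = modeFun s m (angularPoly s m α ν P) θ φ := by
  have hsq : (Real.sin θ : ℂ) ^ 2 = 1 - (Real.cos θ : ℂ) ^ 2 := mod_cast Real.sin_sq θ
  rw [angularExpr, spinLaplacian_modeFun s m P hθ, angularPoly_apply, modeFun_add, modeFun_mul,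
    eval_potentialPoly, Z_modeFun, Z_modeFun]
  simp only [modeFun_mul, eval_C]
  push_cast [-Complex.ofReal_sin, -Complex.ofReal_cos]
  rw [hsq]
  linear_combination modeFun s m P θ φ *
    (α * m ^ 2 * (1 - α / 4 * (1 - Real.cos θ ^ 2)) + α * m * Real.cos θ) * Complex.I_sq

end ModeAction

section ModeSmooth

/-- The function `|z|^|k| e^{i k arg z}`, smooth at the origin: it is a power of `z` or of its
conjugate. -/
def spinPow (k : ℤ) (z : ℂ) : ℂ :=
  if 0 ≤ k then z ^ k.natAbs else conj z ^ k.natAbs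

theorem contDiff_spinPow (k : ℤ) : ContDiff ℝ ∞ (spinPow k) := by
  unfold spinPow
  split_ifs
  · exact contDiff_id.pow _
  · exact Complex.conjCLE.contDiff.pow _

theorem spinPow_polar (k : ℤ) (r φ : ℝ) : spinPow k (r * Complex.exp (I * φ)) =
    (r : ℂ) ^ k.natAbs * Complex.exp (I * k * φ) := by
  unfold spinPow
  split_ifs with h
  · have habs : (k.natAbs : ℂ) = k := by rw [Nat.cast_natAbs, abs_of_nonneg h]
    rw [mul_pow, ← Complex.exp_nat_mul, habs]
    ring_nf
  · have habs : (k.natAbs : ℂ) = -k := by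
      rw [Nat.cast_natAbs, abs_of_neg (not_le.mp h), Int.cast_neg]
    rw [map_mul, mul_pow, ← Complex.exp_conj, ← Complex.exp_nat_mul, habs, Complex.conj_ofReal,
      map_mul, Complex.conj_I, Complex.conj_ofReal]
    ring_nf

/-- The expression of a mode in a stereographic coordinate `z`, in which `cos θ` is
`ε (1 - |z|²)/(1 + |z|²)`, with `ε = 1` at the north pole and `ε = -1` at the south pole. -/
def stereoMode (k : ℤ) (l : ℕ) (ε : ℝ) (P : ℂ[X]) (z : ℂ) : ℂ :=
  spinPow k z * (((1 + ‖z‖ ^ 2)⁻¹ : ℝ) : ℂ) ^ l *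
    P.eval ((ε * (1 - ‖z‖ ^ 2) * (1 + ‖z‖ ^ 2)⁻¹ : ℝ) : ℂ)

theorem contDiff_stereoMode (k : ℤ) (l : ℕ) (ε : ℝ) (P : ℂ[X]) :
    ContDiff ℝ ∞ (stereoMode k l ε P) := by
  have hnorm : ContDiff ℝ ∞ fun z : ℂ => ‖z‖ ^ 2 := contDiff_norm_sq ℝ
  have hinv : ContDiff ℝ ∞ fun z : ℂ => (1 + ‖z‖ ^ 2)⁻¹ :=
    (contDiff_const.add hnorm).inv fun z => by positivity
  have hP : ContDiff ℝ ∞ fun z : ℂ => P.eval z := by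
    simpa only [coe_aeval_eq_eval] using (P.contDiff_aeval (𝕜 := ℂ) ∞).restrict_scalars ℝ
  exact ((contDiff_spinPow k).mul ((contDiff_ofReal.comp hinv).pow l)).mul
    (hP.comp (contDiff_ofReal.comp ((contDiff_const.mul (contDiff_const.sub hnorm)).mul hinv)))

theorem stereoMode_polar {k : ℤ} {l j : ℕ} (hl : k.natAbs + j = 2 * l) (ε : ℝ) (P : ℂ[X])
    {x y : ℝ} (hx : x ≠ 0) (hxy : x ^ 2 + y ^ 2 = 1) (φ : ℝ) :
    stereoMode k l ε P ((y / x : ℝ) * Complex.exp (I * φ)) =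
      Complex.exp (I * k * φ) * ((y : ℂ) ^ k.natAbs * (x : ℂ) ^ j *
        P.eval ((ε * (x ^ 2 - y ^ 2) : ℝ) : ℂ)) := by
  have hnorm : ‖((y / x : ℝ) : ℂ) * Complex.exp (I * φ)‖ ^ 2 = (y / x) ^ 2 := by
    rw [norm_mul, mul_comm I, Complex.norm_exp_ofReal_mul_I, mul_one, Complex.norm_real,
      Real.norm_eq_abs, sq_abs]
  have hinv : (1 + (y / x) ^ 2)⁻¹ = x ^ 2 := by
    rw [div_pow, ← div_self (pow_ne_zero 2 hx), ← add_div, hxy, one_div, inv_inv]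
  have hcos : ε * (1 - (y / x) ^ 2) * x ^ 2 = ε * (x ^ 2 - y ^ 2) := by field_simp
  have hpow : ((x ^ 2 : ℝ) : ℂ) ^ l = (x : ℂ) ^ k.natAbs * (x : ℂ) ^ j := by
    rw [← pow_add, hl, pow_mul, Complex.ofReal_pow]
  have hx' : (x : ℂ) ≠ 0 := by exact_mod_cast hx
  rw [stereoMode, hnorm, hinv, hcos, spinPow_polar, hpow, Complex.ofReal_div, div_pow]
  field_simp

theorem isSmoothSpinWeighted_modeFun (s m : ℤ) (P : ℂ[X]) :
    IsSmoothSpinWeighted s (modeFun s m P) := by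
  refine ⟨stereoMode (m + s) (lowestSpin s m) 1 P, stereoMode (m - s) (lowestSpin s m) (-1) P,
    contDiff_stereoMode _ _ _ _, contDiff_stereoMode _ _ _ _, fun θ hθ φ => ?_⟩
  have hsin : Real.sin (θ / 2) ≠ 0 :=
    (Real.sin_pos_of_mem_Ioo ⟨by linarith [hθ.1], by linarith [hθ.2, Real.pi_pos]⟩).ne'
  have hcos : Real.cos (θ / 2) ≠ 0 :=
    (Real.cos_pos_of_mem_Ioo ⟨by linarith [hθ.1, Real.pi_pos], by linarith [hθ.2]⟩).ne'
  have hdouble : Real.cos (θ / 2) ^ 2 - Real.sin (θ / 2) ^ 2 = Real.cos θ := by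
    rw [← Real.cos_two_mul', mul_div_cancel₀ _ two_ne_zero]
  have hnorth := northOrder_add_southOrder s m
  have hsouth := (add_comm _ _).trans hnorth
  rw [← Complex.ofReal_inv, Real.tan_eq_sin_div_cos, inv_div,
    stereoMode_polar hnorth 1 P hcos (Real.cos_sq_add_sin_sq _),
    stereoMode_polar hsouth (-1) P hsin (Real.sin_sq_add_cos_sq _), one_mul, neg_one_mul, neg_sub,
    hdouble, modeFun, modeProfile]
  constructor
  · rw [← mul_assoc, ← Complex.exp_add]
    push_cast [northOrder]
    ring_nf
  · rw [← mul_assoc, ← Complex.exp_add]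
    push_cast [southOrder]
    ring_nf

end ModeSmooth

section Graph

/-- The graph of `angularExpr s α ν` acting on smooth functions of spin weight `s`, as a set of
pairs of classes in `L²(dΩ)`. -/
def smoothAngularGraph (s : ℤ) (α ν : ℝ) : Set (SphereL2 × SphereL2) :=
  {p | ∃ f : ℝ → ℝ → ℂ, IsSmoothSpinWeighted s f ∧
    (p.1 =ᵐ[sphereMeasure] fun x => f x.1 x.2) ∧
    (p.2 =ᵐ[sphereMeasure] fun x => angularExpr s α ν f x.1 x.2)}

/-- The graph of the closure in `L²(dΩ)` of `angularExpr s α ν` acting on smooth functions of spin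
weight `s`. -/
def angularGraph (s : ℤ) (α ν : ℝ) : Set (SphereL2 × SphereL2) :=
  closure (smoothAngularGraph s α ν)

/-- The coefficient of `Z²` in `angularExpr s α ν`. -/
def secondCoeff (α θ : ℝ) : ℂ :=
  ((α * (1 - α / 4 * Real.sin θ ^ 2) : ℝ) : ℂ) - (Real.sin θ : ℂ)⁻¹ ^ 2

/-- The coefficient of `Z` in `angularExpr s α ν`. -/
def firstCoeff (s : ℤ) (α ν θ : ℝ) : ℂ :=
  ν + I * α * Real.cos θ - 2 * I * s * Real.cos θ * (Real.sin θ : ℂ)⁻¹ ^ 2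

/-- The coefficient of order zero in `angularExpr s α ν`. -/
def zerothCoeff (s : ℤ) (θ : ℝ) : ℂ :=
  (s : ℂ) ^ 2 * ((Real.cos θ : ℂ) / Real.sin θ) ^ 2 + s ^ 2

theorem contDiffOn_inv_sin : ContDiffOn ℝ ∞ (fun θ : ℝ => (Real.sin θ : ℂ)⁻¹) (Ioo 0 π) :=
  contDiff_ofReal_sin.contDiffOn.inv fun _ hθ =>
    Complex.ofReal_ne_zero.mpr (Real.sin_pos_of_mem_Ioo hθ).ne'

theorem contDiffOn_secondCoeff (α : ℝ) : ContDiffOn ℝ ∞ (secondCoeff α) (Ioo 0 π) := by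
  have hreal : ContDiff ℝ ∞ fun θ : ℝ => α * (1 - α / 4 * Real.sin θ ^ 2) := by fun_prop
  exact (contDiff_ofReal.comp hreal).contDiffOn.sub (contDiffOn_inv_sin.pow 2)

theorem contDiffOn_firstCoeff (s : ℤ) (α ν : ℝ) :
    ContDiffOn ℝ ∞ (firstCoeff s α ν) (Ioo 0 π) := by
  have hcos : ContDiffOn ℝ ∞ (fun θ : ℝ => (Real.cos θ : ℂ)) (Ioo 0 π) :=
    (contDiff_ofReal.comp Real.contDiff_cos).contDiffOn
  exact (contDiffOn_const.add (contDiffOn_const.mul hcos)).sub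
    ((contDiffOn_const.mul hcos).mul (contDiffOn_inv_sin.pow 2))

variable {s : ℤ} {α ν : ℝ}

theorem angularExpr_eq_axisymmetricExpr (f : ℝ → ℝ → ℂ) (θ φ : ℝ) : angularExpr s α ν f θ φ =
    axisymmetricExpr (secondCoeff α) (firstCoeff s α ν) (zerothCoeff s) f θ φ := by
  rw [angularExpr, spinLaplacian, axisymmetricExpr, secondCoeff, firstCoeff, zerothCoeff]
  ring

/-- Changing the sign of `ν` gives the formal adjoint. -/
theorem conj_angularExpr {f : ℝ → ℝ → ℂ} (hf : SmoothStrip 0 π f) {θ : ℝ} (hθ : θ ∈ Ioo 0 π)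
    (φ : ℝ) : conj (angularExpr s α ν f θ φ) =
      axisymmetricExpr (secondCoeff α) (-firstCoeff s α (-ν)) (zerothCoeff s)
        (fun t p => conj (f t p)) θ φ := by
  rw [angularExpr_eq_axisymmetricExpr, conj_axisymmetricExpr hf hθ]
  congr 1 <;> ext t <;>
    simp only [Pi.conj_apply, Pi.neg_apply, secondCoeff, firstCoeff, zerothCoeff, map_add, map_sub,
      map_mul, map_pow, map_inv₀, map_div₀, map_ofNat, map_intCast, Complex.conj_ofReal,
      Complex.conj_I, Complex.ofReal_neg]
  ring

theorem add_mem_smoothAngularGraph {p q : SphereL2 × SphereL2} (hp : p ∈ smoothAngularGraph s α ν)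
    (hq : q ∈ smoothAngularGraph s α ν) : p + q ∈ smoothAngularGraph s α ν := by
  obtain ⟨f, hf, hpf, hpf'⟩ := hp
  obtain ⟨g, hg, hqg, hqg'⟩ := hq
  refine ⟨fun θ φ => f θ φ + g θ φ, hf.add hg, ?_, ?_⟩
  · filter_upwards [Lp.coeFn_add p.1 q.1, hpf, hqg] with x hadd hf hg
    rw [Prod.fst_add, hadd, Pi.add_apply, hf, hg]
  · filter_upwards [Lp.coeFn_add p.2 q.2, hpf', hqg', ae_mem_coordRect] with x hadd hf' hg' hx
    rw [Prod.snd_add, hadd, Pi.add_apply, hf', hg', angularExpr_eq_axisymmetricExpr,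
      angularExpr_eq_axisymmetricExpr, angularExpr_eq_axisymmetricExpr,
      axisymmetricExpr_add hf.isTame.smooth hg.isTame.smooth hx.1]

variable (s α ν) in
theorem coeFn_modeL2_angularPoly (m : ℤ) (P : ℂ[X]) :
    modeL2 s m (angularPoly s m α ν P) =ᵐ[sphereMeasure]
      fun x => angularExpr s α ν (modeFun s m P) x.1 x.2 := by
  filter_upwards [coeFn_modeL2 s m (angularPoly s m α ν P), ae_mem_coordRect] with x hcoe hx
  rw [hcoe, angularExpr_modeFun s m α ν P hx.1]

theorem modeL2_mem_smoothAngularGraph (m : ℤ) (P : ℂ[X]) :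
    (modeL2 s m P, modeL2 s m (angularPoly s m α ν P)) ∈ smoothAngularGraph s α ν :=
  ⟨modeFun s m P, isSmoothSpinWeighted_modeFun s m P, coeFn_modeL2 s m P,
    coeFn_modeL2_angularPoly s α ν m P⟩

theorem inner_modeL2_of_mem_smoothAngularGraph {p : SphereL2 × SphereL2}
    (hp : p ∈ smoothAngularGraph s α ν) (m : ℤ) (P : ℂ[X]) :
    ⟪p.1, modeL2 s m (angularPoly s m α (-ν) P)⟫_ℂ = ⟪p.2, modeL2 s m P⟫_ℂ := by
  obtain ⟨f, hf, hpf, hpf'⟩ := hp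
  have hmode := (isSmoothSpinWeighted_modeFun s m P).isTame
  have hint₁ := L2.integrable_inner (𝕜 := ℂ) p.1 (modeL2 s m (angularPoly s m α (-ν) P))
  have hint₂ := L2.integrable_inner (𝕜 := ℂ) p.2 (modeL2 s m P)
  have hae : (fun x => ⟪p.1 x, modeL2 s m (angularPoly s m α (-ν) P) x⟫_ℂ -
      ⟪p.2 x, modeL2 s m P x⟫_ℂ) =ᵐ[sphereMeasure] fun x : ℝ × ℝ => conj (f x.1 x.2) *
          axisymmetricExpr (secondCoeff α) (firstCoeff s α (-ν)) (zerothCoeff s) (modeFun s m P)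
            x.1 x.2 -
        modeFun s m P x.1 x.2 *
          axisymmetricExpr (secondCoeff α) (-firstCoeff s α (-ν)) (zerothCoeff s)
            (fun θ φ => conj (f θ φ)) x.1 x.2 := by
    filter_upwards [hpf, hpf', coeFn_modeL2 s m P, coeFn_modeL2_angularPoly s α (-ν) m P,
      ae_mem_coordRect] with x hf₁ hf₂ hmode₁ hmode₂ hx
    rw [hf₁, hf₂, hmode₁, hmode₂, RCLike.inner_apply, RCLike.inner_apply,
      conj_angularExpr hf.isTame.smooth hx.1, angularExpr_eq_axisymmetricExpr, mul_comm]
  have hgreen := green_identity hmode hf.isTame.star (contDiffOn_secondCoeff α)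
    (contDiffOn_firstCoeff s α (-ν)) ((hint₁.sub hint₂).congr hae)
  rw [← integral_congr_ae hae, integral_sub hint₁ hint₂] at hgreen
  rw [L2.inner_def, L2.inner_def]
  exact sub_eq_zero.mp hgreen

theorem inner_modeL2_of_mem_angularGraph {p : SphereL2 × SphereL2}
    (hp : p ∈ angularGraph s α ν) (m : ℤ) (P : ℂ[X]) :
    ⟪p.1, modeL2 s m (angularPoly s m α (-ν) P)⟫_ℂ = ⟪p.2, modeL2 s m P⟫_ℂ :=
  closure_minimal (fun _ hq => inner_modeL2_of_mem_smoothAngularGraph hq m P)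
    (isClosed_eq (by fun_prop) (by fun_prop)) hp

theorem angularGraph_unique {u h₁ h₂ : SphereL2} (hu₁ : (u, h₁) ∈ angularGraph s α ν)
    (hu₂ : (u, h₂) ∈ angularGraph s α ν) : h₁ = h₂ := by
  refine sub_eq_zero.mp (eq_zero_of_inner_modeL2_eq_zero s fun m P => ?_)
  rw [inner_sub_left, sub_eq_zero]
  exact (inner_modeL2_of_mem_angularGraph hu₁ m P).symm.trans
    (inner_modeL2_of_mem_angularGraph hu₂ m P)

theorem eq_zero_of_inner_angularPoly_eq_zero (hs : s ≠ 0) (hα : α ≤ ν ^ 2) {v : SphereL2}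
    (hv : ∀ m P, ⟪v, modeL2 s m (angularPoly s m α ν P)⟫_ℂ = 0) : v = 0 :=
  eq_zero_of_inner_modeL2_eq_zero s fun m => inner_modeL2_eq_zero_of_angularPoly hs hα (hv m)

theorem angularGraph_injective (hs : s ≠ 0) (hα : α ≤ ν ^ 2) {u₁ u₂ h : SphereL2}
    (hu₁ : (u₁, h) ∈ angularGraph s α ν) (hu₂ : (u₂, h) ∈ angularGraph s α ν) : u₁ = u₂ := by
  refine sub_eq_zero.mp (eq_zero_of_inner_angularPoly_eq_zero (α := α) (ν := -ν) hs
    (by rwa [neg_sq]) fun m P => ?_)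
  rw [inner_sub_left, sub_eq_zero]
  exact (inner_modeL2_of_mem_angularGraph hu₁ m P).trans
    (inner_modeL2_of_mem_angularGraph hu₂ m P).symm

variable (s α ν)

/-- Finite sums of modes, as elements of `L²(dΩ)`. -/
def modeSum : (ℤ →₀ ℂ[X]) →ₗ[ℂ] SphereL2 := Finsupp.lsum ℂ (modeL2 s)

/-- The operator `angularExpr s α ν` on finite sums of modes. -/
def angularSum : (ℤ →₀ ℂ[X]) →ₗ[ℂ] SphereL2 :=
  Finsupp.lsum ℂ fun m => (modeL2 s m).comp (angularPoly s m α ν)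

theorem modeSum_mem_smoothAngularGraph (v : ℤ →₀ ℂ[X]) :
    (modeSum s v, angularSum s α ν v) ∈ smoothAngularGraph s α ν := by
  induction v using Finsupp.induction_linear with
  | zero => simpa using modeL2_mem_smoothAngularGraph (s := s) (α := α) (ν := ν) 0 0
  | add v w hv hw =>
    rw [map_add, map_add, ← Prod.mk_add_mk]
    exact add_mem_smoothAngularGraph hv hw
  | single m P => simpa [modeSum, angularSum] using modeL2_mem_smoothAngularGraph m P

theorem norm_sum_modeL2_sq (S : Finset ℤ) (P : ℤ → ℂ[X]) :
    ‖∑ m ∈ S, modeL2 s m (P m)‖ ^ 2 = ∑ m ∈ S, ‖modeL2 s m (P m)‖ ^ 2 := by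
  induction S using Finset.induction_on with
  | empty => simp
  | insert m S hm ih =>
    rw [Finset.sum_insert hm, Finset.sum_insert hm, ← ih, sq, sq, sq]
    refine norm_add_sq_eq_norm_sq_add_norm_sq_of_inner_eq_zero (𝕜 := ℂ) _ _ ?_
    rw [inner_sum]
    exact Finset.sum_eq_zero fun n hn => inner_modeL2_of_ne s (ne_of_mem_of_not_mem hn hm).symm _ _

variable {s α ν}

theorem norm_modeSum_le (hs : s ≠ 0) (hα : α ≤ ν ^ 2) (v : ℤ →₀ ℂ[X]) :
    ‖modeSum s v‖ ≤ 2 * ‖angularSum s α ν v‖ := by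
  have hsum : modeSum s v = ∑ m ∈ v.support, modeL2 s m (v m) := rfl
  have hangular : angularSum s α ν v =
    ∑ m ∈ v.support, modeL2 s m (angularPoly s m α ν (v m)) := rfl
  refine le_of_sq_le_sq ?_ (by positivity)
  rw [mul_pow, hsum, hangular, norm_sum_modeL2_sq,
    norm_sum_modeL2_sq s v.support fun m => angularPoly s m α ν (v m), Finset.mul_sum]
  refine Finset.sum_le_sum fun m _ => ?_
  have hmode := mul_norm_le_of_le_norm_inner
    (half_mul_le_norm_inner_angularPoly (m := m) hs hα (v m))
  rw [← mul_pow]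
  gcongr
  linarith

theorem denseRange_angularSum (hs : s ≠ 0) (hα : α ≤ ν ^ 2) :
    DenseRange (angularSum s α ν) := by
  have hortho : (LinearMap.range (angularSum s α ν))ᗮ = ⊥ := by
    refine (Submodule.eq_bot_iff _).mpr fun v hv =>
      eq_zero_of_inner_angularPoly_eq_zero hs hα fun m P => ?_
    simpa [angularSum] using (Submodule.mem_orthogonal' _ _).mp hv _
      (LinearMap.mem_range_self (angularSum s α ν) (Finsupp.single m P))
  rw [DenseRange, ← LinearMap.coe_range]
  exact Submodule.dense_iff_topologicalClosure_eq_top.mpr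
    (Submodule.topologicalClosure_eq_top_iff.mpr hortho)

theorem exists_angularGraph_inverse (hs : s ≠ 0) (hα : α ≤ ν ^ 2) :
    ∃ R : SphereL2 →L[ℂ] SphereL2, ‖R‖ ≤ 2 ∧
      ∀ u h, (u, h) ∈ angularGraph s α ν ↔ u = R h := by
  obtain ⟨R, hR, hclosure⟩ := exists_bounded_inverse_of_denseRange (modeSum s) (angularSum s α ν)
    zero_le_two (norm_modeSum_le hs hα) (denseRange_angularSum hs hα)
  have hmem : ∀ h, (R h, h) ∈ angularGraph s α ν := fun h =>
    closure_mono (range_subset_iff.mpr (modeSum_mem_smoothAngularGraph s α ν)) (hclosure h)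
  exact ⟨R, hR, fun u h =>
    ⟨fun hu => angularGraph_injective hs hα hu (hmem h), fun hu => hu ▸ hmem h⟩⟩

end Graph

section Horizon

theorem le_rPlus (M a : ℝ) : M ≤ rPlus M a := le_add_of_nonneg_right (Real.sqrt_nonneg _)

theorem horizonExpr_eq_angularExpr {M : ℝ} (hM : 0 < M) (a : ℝ) :
    horizonExpr M a = angularExpr (-1) (a ^ 2 / (M * rPlus M a)) (a / M) := by
  have hM' : (M : ℂ) ≠ 0 := by exact_mod_cast hM.ne'
  have hr : (rPlus M a : ℂ) ≠ 0 := by exact_mod_cast (hM.trans_le (le_rPlus M a)).ne'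
  ext f θ φ
  rw [horizonExpr, angularExpr]
  push_cast
  field_simp

theorem horizonGraph_eq_angularGraph {M : ℝ} (hM : 0 < M) (a : ℝ) :
    horizonGraph M a = angularGraph (-1) (a ^ 2 / (M * rPlus M a)) (a / M) := by
  rw [horizonGraph, smoothGraph, horizonExpr_eq_angularExpr hM]
  rfl

theorem sq_div_mul_rPlus_le {M : ℝ} (hM : 0 < M) (a : ℝ) :
    a ^ 2 / (M * rPlus M a) ≤ (a / M) ^ 2 := by
  rw [div_pow, sq M]
  gcongr
  exact le_rPlus M a

end Horizon

end

end KerrHorizon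

theorem lemma6p8_general (s : ℤ) (hs : s ≠ 0) (α ν : ℝ) (hα : α ≤ ν ^ 2) :
    (∀ u h₁ h₂ : KerrHorizon.SphereL2, (u, h₁) ∈ KerrHorizon.angularGraph s α ν →
      (u, h₂) ∈ KerrHorizon.angularGraph s α ν → h₁ = h₂) ∧
    (∃ R : KerrHorizon.SphereL2 →L[ℂ] KerrHorizon.SphereL2, ‖R‖ ≤ 2 ∧
      ∀ u h : KerrHorizon.SphereL2, (u, h) ∈ KerrHorizon.angularGraph s α ν ↔ u = R h) ∧
    (∀ (ev : ℂ) (u : KerrHorizon.SphereL2), u ≠ 0 →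
      (u, ev • u) ∈ KerrHorizon.angularGraph s α ν → 1 / 2 ≤ ‖ev‖) := by
  obtain ⟨R, hR, hgraph⟩ := KerrHorizon.exists_angularGraph_inverse hs hα
  refine ⟨fun u h₁ h₂ => KerrHorizon.angularGraph_unique, ⟨R, hR, hgraph⟩, fun ev u hu hev => ?_⟩
  have hone : 1 ≤ ‖R‖ * ‖ev‖ :=
    KerrHorizon.one_le_opNorm_mul_norm_of_eq_apply_smul R hu ((hgraph _ _).mp hev)
  linarith [mul_le_mul_of_nonneg_right hR (norm_nonneg ev)]

/-- The horizon spin `-1` angular operator is a well-defined (single-valued) closed operator on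
`L²(dΩ)`; it is invertible, with an everywhere defined inverse of norm at most `2`; and its
eigenvalues have modulus at least `1/2`, for all `|a| ≤ M`. -/
theorem lemma6p8 (M a : ℝ) (hM : 0 < M) (ha : |a| ≤ M) :
    (∀ u h₁ h₂ : KerrHorizon.SphereL2, (u, h₁) ∈ KerrHorizon.horizonGraph M a →
      (u, h₂) ∈ KerrHorizon.horizonGraph M a → h₁ = h₂) ∧
    (∃ R : KerrHorizon.SphereL2 →L[ℂ] KerrHorizon.SphereL2, ‖R‖ ≤ 2 ∧
      ∀ u h : KerrHorizon.SphereL2, (u, h) ∈ KerrHorizon.horizonGraph M a ↔ u = R h) ∧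
    (∀ (ev : ℂ) (u : KerrHorizon.SphereL2), u ≠ 0 →
      (u, ev • u) ∈ KerrHorizon.horizonGraph M a → 1 / 2 ≤ ‖ev‖) := by
  rw [KerrHorizon.horizonGraph_eq_angularGraph hM]
  exact lemma6p8_general (-1) (by norm_num) _ _ (KerrHorizon.sq_div_mul_rPlus_le hM a)
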